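/- **Setting.** An HRLQ instance $G=(\mathcal R\cup\mathcal H,E)$ is a finite bipartite graph in which every vertex has a strict preference list over its neighbours and every hospital $h$ has an upper quota $q^+(h)$ and a lower quota $q^-(h)$. A *matching* is a set $M\subseteq E$ with $|M(r)|\le 1$ for every resident $r$ and $|M(h)|\le q^+(h)$ for every hospital $h$, where $M(v)$ is the set of neighbours of $v$ in $M$; it is *feasible* if moreover $|M(h)|\ge q^-(h)$ for all $h$. An HR instance is the same without lower quotas (with capacities as upper quotas). A matching in an HR instance is *stable* if there is no edge $(r,h)$ such that $r$ is unmatched or prefers $h$ to its hospital, and $h$ is not full or prefers $r$ to one of its residents. **Votes.** Every vertex prefers each neighbour to $\bot$ (unmatched). Let $\mathrm{vote}_v(x,y)=1$ if $v$ prefers $x$ to $y$, $-1$ if $v$ prefers $y$ to $x$, and $0$ if $x=y$. A resident $r$ gives $\mathrm{vote}_r(M_1(r),M_2(r))$ to $M_1$ against $M_2$. For each hospital $h$ and each pair of matchings, let $\mathrm{corr}_h$ be an arbitrary pairing of $M_1(h)\setminus M_2(h)$ with $M_2(h)\setminus M_1(h)$ in which the excess elements of the larger set, and only these, are paired with $\bot$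 (the pairing for $(M_2,M_1)$ being the inverse of that for $(M_1,M_2)$); $h$ gives the sum of $\mathrm{vote}_h(x,y)$ over all pairs $(x,y)$ of this pairing, with $x$ on the side of $M_1$ and $y$ on the side of $M_2$. Let $\Delta(M_1,M_2)$ be the sum of the votes of all vertices for $M_1$ against $M_2$. A feasible $M$ is *popular among all feasible matchings* if no feasible $N$ satisfies $\Delta(N,M)>\Delta(M,N)$. **Components.** Two edges of $M\oplus N$, one in $M\setminus N$ and one in $N\setminus M$, are consecutive if they share their resident, or share their hospital $h$ and their residents are paired with each other by $\mathrm{corr}_h$ for $(M,N)$. This decomposes $M\oplus N$ into alternating cycles and maximal alternating paths (possibly with repeated vertices). An end-point of a path is matched in $M$ if the edge of the path at this end is in $M$. **The reduced instance $G'$.** Let $\ell=2+\sum_{h}q^-(h)$. Each hospital $h$ has copies $h^0,\dots,h^{\ell-1}$, with capacity $q^+(h)$ for $h^0,h^1$ and $q^-(h)$ for $h^s$, $s\ge 2$. Besides $\mathcal R$ there are, for each $h$ and $0\le s\le \ell-2$, dummy residents $\mathcal D^s_h=\{d^s_{h,1},\dots,d^s_{h,c}\}$, where $c$ is the capacity of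 $h^s$; as a list, $\mathcal D^s_h$ is ordered by increasing index, and $\mathcal D_h^{\ell-1}=\emptyset$. The list of $h^s$ is $T^s_h\circ\langle list_h\rangle\circ\langle\mathcal D^s_h\rangle$, where $T^0_h$ is empty, $T^2_h$ consists of the last $q^-(h)$ elements of $\mathcal D^1_h$, and $T^s_h=\mathcal D^{s-1}_h$ for all other $s$. A resident $r\in\mathcal R$ lists the level-$(\ell-1)$ copies in the order of $list_r$, then the level-$(\ell-2)$ copies in the same order, and so on down to level $0$. The dummy $d^s_{h,i}$ has the list $\langle h^s,h^{s+1}\rangle$, except that it is $\langle h^1\rangle$ if $s=1$ and $i\le q^+(h)-q^-(h)$. For a matching $M'$ in $G'$, $\mathrm{map}(M')$ is the set of all $(r,h)$, $r\in\mathcal R$, such that $M'$ matches $r$ to some copy of $h$. **Theorem.** Let $M=\mathrm{map}(M')$, where $M'$ is a stable matching in $G'$, and let $N$ be any feasible matching in $G$. For all choices of the correspondences $\mathrm{corr}_h$: 1. if $\rho$ is an alternating cycle in the decomposition of $M\oplus N$, then $M\oplus\rho$ is feasible and $\Delta(M\oplus\rho,M)\le\Delta(M,M\oplus\rho)$; 2.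 the same holds if $\rho$ is an alternating path in the decomposition of $M\oplus N$ with exactly one end-point matched in $M$; 3. the same holds if $\rho$ is an alternating path in the decomposition of $M\oplus N$ with both end-points matched in $M$. Moreover, if $G$ has a feasible matching, then for every stable matching $M'$ in $G'$ the set $M=\mathrm{map}(M')$ is a feasible matching that is popular among all feasible matchings, for all choices of the correspondences; and a stable matching $M'$ in $G'$, hence such an $M$, exists. -/

import Mathlib

open scoped symmDiff

/-! ### Preference lists -/

/-- `Prefers l x y`: an agent with strict preference list `l` (most preferred first) prefers `x`
to `y`; `none` is the option `⊥` (unmatched), to which every member of the list is preferred. -/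
def Prefers {α : Type*} [DecidableEq α] (l : List α) : Option α → Option α → Prop
  | some x, some y => x ∈ l ∧ y ∈ l ∧ l.idxOf x < l.idxOf y
  | some x, none => x ∈ l
  | none, _ => False

open Classical in
/-- The vote of an agent with preference list `l` between `x` and `y`. -/
noncomputable def vote {α : Type*} [DecidableEq α] (l : List α) (x y : Option α) : ℤ :=
  if Prefers l x y then 1 else if Prefers l y x then -1 else 0

/-! ### Hospital residents instances -/

/-- A hospital residents instance with residents `R` and hospitals `H`.  The edges of the
bipartite graph are the pairs `(r, h)` with `h ∈ listR r`, equivalently `r ∈ listH h`. -/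
structure HRInstance (R H : Type*) where
  /-- the preference list of a resident -/
  listR : R → List H
  /-- the preference list of a hospital -/
  listH : H → List R
  /-- the capacity (upper quota) of a hospital -/
  upper : H → ℕ
  nodupR : ∀ r, (listR r).Nodup
  nodupH : ∀ h, (listH h).Nodup
  mem_iff : ∀ r h, h ∈ listR r ↔ r ∈ listH h

/-- `M(h)`, the set of residents that `M` assigns to `h`. -/
def residentsOf {R H : Type*} [Fintype R] [DecidableEq R] [DecidableEq H]
    (M : Finset (R × H)) (h : H) : Finset R :=
  Finset.univ.filter fun r => (r, h) ∈ M

open Classical in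
/-- `M(r)`, the hospital that `M` assigns to `r`, or `none` if `r` is unmatched.  (It is used only
for sets `M` that contain at most one pair for each resident.) -/
noncomputable def hospitalOf {R H : Type*} (M : Finset (R × H)) (r : R) : Option H :=
  if hr : ∃ h, (r, h) ∈ M then some hr.choose else none

namespace HRInstance

variable {R H : Type*} [Fintype R] [DecidableEq R] [DecidableEq H]

/-- A matching: a set of edges with at most one hospital for each resident and at most `upper h`
residents for each hospital `h`. -/
structure IsMatching (G : HRInstance R H) (M : Finset (R × H)) : Prop where
  edge : ∀ r h, (r, h) ∈ M → h ∈ G.listR r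
  resident : ∀ r h₁ h₂, (r, h₁) ∈ M → (r, h₂) ∈ M → h₁ = h₂
  hospital : ∀ h, (residentsOf M h).card ≤ G.upper h

/-- The edge `(r, h)` blocks `M`. -/
def Blocks (G : HRInstance R H) (M : Finset (R × H)) (r : R) (h : H) : Prop :=
  h ∈ G.listR r ∧ Prefers (G.listR r) (some h) (hospitalOf M r) ∧
    ((residentsOf M h).card < G.upper h ∨
      ∃ r' ∈ residentsOf M h, Prefers (G.listH h) (some r) (some r'))

/-- A stable matching: a matching without blocking pairs. -/
def IsStable (G : HRInstance R H) (M : Finset (R × H)) : Prop :=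
  G.IsMatching M ∧ ∀ r h, ¬ G.Blocks M r h

end HRInstance

/-! ### Lower quotas, votes and popularity -/

/-- A hospital residents instance with lower quotas.  (`lower h ≤ upper h` need not be required: it
holds as soon as there is a feasible matching.) -/
structure HRLQInstance (R H : Type*) extends HRInstance R H where
  /-- the lower quota of a hospital -/
  lower : H → ℕ

namespace HRLQInstance

variable {R H : Type*} [Fintype R] [DecidableEq R] [DecidableEq H]

/-- A feasible matching: a matching that also respects the lower quotas. -/
def IsFeasible (G : HRLQInstance R H) (M : Finset (R × H)) : Prop :=
  G.IsMatching M ∧ ∀ h, G.lower h ≤ (residentsOf M h).card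

/-- The correspondences by which the hospitals compare two matchings.  If the unfilled positions of
`h` are filled with copies of `⊥`, then `M₁(h)` and `M₂(h)` both have `upper h` elements; their
common elements (including common copies of `⊥`) cancel, and `h` chooses, for each `M₁` and `M₂`, an
arbitrary bijection between what remains on the two sides.  Thus `M₁(h) \ M₂(h)` and `M₂(h) \ M₁(h)`
are paired in an arbitrary way, and only the excess elements of the larger of the two sets are
paired with `⊥`.  Here `corr h M₁ M₂ r` is the partner of `r ∈ M₁(h) \ M₂(h)`, `none` being `⊥`. -/
structure Correspondence (G : HRLQInstance R H) where
  corr : H → Finset (R × H) → Finset (R × H) → R → Option R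
  mem : ∀ h M₁ M₂, G.IsMatching M₁ → G.IsMatching M₂ →
    ∀ r ∈ residentsOf M₁ h \ residentsOf M₂ h, ∀ r', corr h M₁ M₂ r = some r' →
      r' ∈ residentsOf M₂ h \ residentsOf M₁ h
  symm : ∀ h M₁ M₂, G.IsMatching M₁ → G.IsMatching M₂ →
    ∀ r ∈ residentsOf M₁ h \ residentsOf M₂ h, ∀ r', corr h M₁ M₂ r = some r' →
      corr h M₂ M₁ r' = some r
  excess : ∀ h M₁ M₂, G.IsMatching M₁ → G.IsMatching M₂ →
    ∀ r ∈ residentsOf M₁ h \ residentsOf M₂ h, corr h M₁ M₂ r = none →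
      ∀ r' ∈ residentsOf M₂ h \ residentsOf M₁ h, corr h M₂ M₁ r' ≠ none

/-- The vote of the resident `r` between two matchings. -/
noncomputable def voteR (G : HRLQInstance R H) (M₁ M₂ : Finset (R × H)) (r : R) : ℤ :=
  vote (G.listR r) (hospitalOf M₁ r) (hospitalOf M₂ r)

/-- The sum of the votes of the positions of the hospital `h` between two matchings.  The second sum
is over the positions that are filled in `M₂` only. -/
noncomputable def voteH (G : HRLQInstance R H) (c : G.Correspondence)
    (M₁ M₂ : Finset (R × H)) (h : H) : ℤ :=
  (∑ r ∈ residentsOf M₁ h \ residentsOf M₂ h, vote (G.listH h) (some r) (c.corr h M₁ M₂ r)) +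
    ∑ r ∈ (residentsOf M₂ h \ residentsOf M₁ h).filter (fun r => c.corr h M₂ M₁ r = none),
      vote (G.listH h) none (some r)

/-- `Δ(M₁, M₂)`, the total vote of all residents and hospitals for `M₁` against `M₂`. -/
noncomputable def delta [Fintype H] (G : HRLQInstance R H) (c : G.Correspondence)
    (M₁ M₂ : Finset (R × H)) : ℤ :=
  ∑ r, G.voteR M₁ M₂ r + ∑ h, G.voteH c M₁ M₂ h

/-- `M₁` is more popular than `M₂`. -/
def MorePopular [Fintype H] (G : HRLQInstance R H) (c : G.Correspondence)
    (M₁ M₂ : Finset (R × H)) : Prop :=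
  G.delta c M₂ M₁ < G.delta c M₁ M₂

/-- `M` is a feasible matching that is popular among all feasible matchings. -/
def IsPopularFeasible [Fintype H] (G : HRLQInstance R H) (c : G.Correspondence)
    (M : Finset (R × H)) : Prop :=
  G.IsFeasible M ∧ ∀ N, G.IsFeasible N → ¬ G.MorePopular c N M

/-! ### The decomposition of `M ⊕ N` into alternating paths and cycles -/

/-- The edge `e` of `M \ N` and the edge `f` of `N \ M` are consecutive in the decomposition: either
they have the same resident, or they have the same hospital and their residents correspond to each
other at this hospital. -/
def Linked (G : HRLQInstance R H) (c : G.Correspondence) (M N : Finset (R × H))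
    (e f : R × H) : Prop :=
  e ∈ M \ N ∧ f ∈ N \ M ∧ (e.1 = f.1 ∨ (e.2 = f.2 ∧ c.corr e.2 M N e.1 = some f.1))

/-- The graph on the edges of `M ⊕ N` in which consecutive edges are adjacent. -/
def linkGraph (G : HRLQInstance R H) (c : G.Correspondence) (M N : Finset (R × H)) :
    SimpleGraph (R × H) where
  Adj e f := G.Linked c M N e f ∨ G.Linked c M N f e
  symm := ⟨fun _ _ h => h.symm⟩
  loopless := ⟨fun e h => by
    have h' : G.Linked c M N e e := h.elim id id
    exact (Finset.mem_sdiff.1 h'.2.1).2 (Finset.mem_sdiff.1 h'.1).1⟩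

/-- `ρ` is (the edge set of) an alternating cycle in the decomposition of `M ⊕ N`. -/
def IsAltCycle (G : HRLQInstance R H) (c : G.Correspondence) (M N ρ : Finset (R × H)) : Prop :=
  ∃ (e : R × H) (p : (G.linkGraph c M N).Walk e e), p.IsCycle ∧ p.support.toFinset = ρ

/-- The vertex `u` is an end of the edge `e` at which `e` has no consecutive edge, that is, a path
that arrives at `u` through `e` cannot be extended. -/
def IsEndPoint (G : HRLQInstance R H) (c : G.Correspondence) (M N : Finset (R × H))
    (e : R × H) : R ⊕ H → Prop
  | Sum.inl r => e.1 = r ∧ ∀ g, (G.linkGraph c M N).Adj e g → g.1 ≠ r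
  | Sum.inr h => e.2 = h ∧ ∀ g, (G.linkGraph c M N).Adj e g → g.2 ≠ h

/-- `ρ` is (the edge set of) an alternating path in the decomposition of `M ⊕ N`, with end edges `e`
and `f` and end-points `u` (an end of `e`) and `v` (an end of `f`).  The path may be non-simple as a
sequence of vertices, but its edges are distinct; it may consist of a single edge `e = f`, whose two
ends are then the end-points.  The end-point `u` is matched in `M` (on the path) if `e ∈ M`, and `v`
if `f ∈ M`. -/
def IsAltPath (G : HRLQInstance R H) (c : G.Correspondence) (M N ρ : Finset (R × H))
    (e f : R × H) (u v : R ⊕ H) : Prop :=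
  e ∈ M ∆ N ∧ G.IsEndPoint c M N e u ∧ G.IsEndPoint c M N f v ∧ (e = f → u ≠ v) ∧
    ∃ p : (G.linkGraph c M N).Walk e f, p.IsPath ∧ p.support.toFinset = ρ

end HRLQInstance

/-! ### The reduction to a hospital residents instance -/

namespace HRLQInstance

variable {R H : Type*} [Fintype H]

/-- The number `ℓ` of level copies of every hospital. -/
def numLevels (G : HRLQInstance R H) : ℕ := 2 + ∑ h, G.lower h

/-- The capacity of the level-`s` copy of `h`, which is also the number of level-`s` dummies. -/
def copyCap (G : HRLQInstance R H) (h : H) (s : ℕ) : ℕ :=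
  if s ≤ 1 then G.upper h else G.lower h

/-- The dummy residents `d^s_{h,i}`, for `s ∈ {0, …, ℓ - 2}`; the index `i` starts at `0`. -/
abbrev Dummy (G : HRLQInstance R H) : Type _ :=
  (h : H) × (s : Fin (G.numLevels - 1)) × Fin (G.copyCap h s)

/-- The residents of the reduced instance: the residents and the dummy residents. -/
abbrev Resident' (G : HRLQInstance R H) : Type _ := R ⊕ G.Dummy

/-- The hospitals of the reduced instance: `(h, s)` is the level-`s` copy of `h`. -/
abbrev Hospital' (G : HRLQInstance R H) : Type _ := H × Fin G.numLevels

/-- The level-`s` dummies of `h` in the order of their indices (none if `s = ℓ - 1`). -/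
def dummies (G : HRLQInstance R H) (h : H) (s : ℕ) : List G.Resident' :=
  if hs : s < G.numLevels - 1 then
    (List.finRange (G.copyCap h s)).map fun i => Sum.inr ⟨h, ⟨s, hs⟩, i⟩
  else []

/-- The dummies at the top of the list of the level-`s` copy of `h`: all level-`(s-1)` dummies if
`s ≠ 2`, and the last `lower h` level-`1` dummies if `s = 2`. -/
def topDummies (G : HRLQInstance R H) (h : H) : ℕ → List G.Resident'
  | 0 => []
  | 1 => G.dummies h 0
  | 2 => (G.dummies h 1).drop (G.upper h - G.lower h)
  | s + 3 => G.dummies h (s + 2)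

/-- The preference list of the level-`s` copy of `h`. -/
def listH' (G : HRLQInstance R H) (x : G.Hospital') : List G.Resident' :=
  G.topDummies x.1 x.2 ++ (G.listH x.1).map Sum.inl ++ G.dummies x.1 x.2

/-- The preference list of a (dummy) resident.  A resident lists the copies of level `ℓ - 1` in the
original order, then those of level `ℓ - 2`, and so on.  A level-`s` dummy of `h` lists the copies
of levels `s` and `s + 1` of `h`, except that the first `upper h - lower h` level-`1` dummies list
only the level-`1` copy. -/
def listR' (G : HRLQInstance R H) : G.Resident' → List G.Hospital'
  | Sum.inl r =>
    (List.finRange G.numLevels).reverse.flatMap fun s => (G.listR r).map fun h => (h, s)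
  | Sum.inr ⟨h, s, i⟩ =>
    if (s : ℕ) = 1 ∧ (i : ℕ) < G.upper h - G.lower h then
      [(h, ⟨s, by omega⟩)]
    else [(h, ⟨s, by omega⟩), (h, ⟨s + 1, by omega⟩)]

theorem mem_dummies (G : HRLQInstance R H) (h : H) (s : ℕ) (x : G.Resident') :
    x ∈ G.dummies h s ↔ ∃ (t : Fin (G.numLevels - 1)) (i : Fin (G.copyCap h t)),
      (t : ℕ) = s ∧ x = Sum.inr ⟨h, t, i⟩ := by
  unfold dummies
  split_ifs with hs
  · simp only [List.mem_map, List.mem_finRange, true_and]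
    constructor
    · rintro ⟨i, rfl⟩
      exact ⟨⟨s, hs⟩, i, rfl, rfl⟩
    · rintro ⟨t, i, rfl, rfl⟩
      exact ⟨i, rfl⟩
  · constructor
    · intro hx
      simp at hx
    · rintro ⟨t, i, rfl, rfl⟩
      exact absurd t.2 hs

theorem mem_dummies_one_drop (G : HRLQInstance R H) (h : H) (k : ℕ) (x : G.Resident') :
    x ∈ (G.dummies h 1).drop k ↔ ∃ (t : Fin (G.numLevels - 1)) (i : Fin (G.copyCap h t)),
      (t : ℕ) = 1 ∧ k ≤ (i : ℕ) ∧ x = Sum.inr ⟨h, t, i⟩ := by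
  unfold dummies
  split_ifs with hs
  · rw [List.mem_drop_iff_getElem]
    simp only [List.getElem_map, List.getElem_finRange, List.length_map, List.length_finRange]
    constructor
    · rintro ⟨i, hi, rfl⟩
      exact ⟨⟨1, hs⟩, ⟨k + i, by simp; omega⟩, rfl, by simp, by simp⟩
    · rintro ⟨⟨t, ht⟩, i, h1, hk, rfl⟩
      obtain rfl : t = 1 := h1
      exact ⟨i - k, by have : (i : ℕ) < G.copyCap h 1 := i.2; omega, by
        congr 3
        ext
        simp
        omega⟩
  · constructor
    · intro hx
      simp at hx
    · rintro ⟨t, i, h1, -, rfl⟩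
      exact absurd t.2 (by omega)

theorem mem_topDummies (G : HRLQInstance R H) (h : H) (s : ℕ) (x : G.Resident') :
    x ∈ G.topDummies h s ↔ ∃ (t : Fin (G.numLevels - 1)) (i : Fin (G.copyCap h t)),
      (t : ℕ) + 1 = s ∧ ¬ ((t : ℕ) = 1 ∧ (i : ℕ) < G.upper h - G.lower h) ∧
        x = Sum.inr ⟨h, t, i⟩ := by
  match s with
  | 0 => simp [topDummies]
  | 1 =>
    rw [topDummies, mem_dummies]
    constructor
    · rintro ⟨t, i, ht, rfl⟩
      exact ⟨t, i, by omega, by omega, rfl⟩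
    · rintro ⟨t, i, ht, -, rfl⟩
      exact ⟨t, i, by omega, rfl⟩
  | 2 =>
    rw [topDummies, mem_dummies_one_drop]
    constructor
    · rintro ⟨t, i, ht, hk, rfl⟩
      exact ⟨t, i, by omega, by omega, rfl⟩
    · rintro ⟨t, i, ht, hk, rfl⟩
      exact ⟨t, i, by omega, by omega, rfl⟩
  | s + 3 =>
    rw [topDummies, mem_dummies]
    constructor
    · rintro ⟨t, i, ht, rfl⟩
      exact ⟨t, i, by omega, by omega, rfl⟩
    · rintro ⟨t, i, ht, -, rfl⟩
      exact ⟨t, i, by omega, rfl⟩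

theorem nodup_dummies (G : HRLQInstance R H) (h : H) (s : ℕ) : (G.dummies h s).Nodup := by
  unfold dummies
  split_ifs with hs
  · refine (List.nodup_finRange _).map ?_
    intro i j hij
    simpa using hij
  · exact List.nodup_nil

theorem nodup_topDummies (G : HRLQInstance R H) (h : H) (s : ℕ) : (G.topDummies h s).Nodup := by
  match s with
  | 0 => exact List.nodup_nil
  | 1 => exact G.nodup_dummies h 0
  | 2 => exact (G.nodup_dummies h 1).sublist (List.drop_sublist _ _)
  | s + 3 => exact G.nodup_dummies h (s + 2)

theorem nodup_listH' (G : HRLQInstance R H) (x : G.Hospital') : (G.listH' x).Nodup := by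
  unfold listH'
  refine List.Nodup.append (List.Nodup.append (G.nodup_topDummies _ _)
    ((G.nodupH x.1).map Sum.inl_injective) ?_) (G.nodup_dummies _ _) ?_
  · intro y h1 h2
    obtain ⟨t, i, -, -, rfl⟩ := (G.mem_topDummies _ _ _).1 h1
    simp at h2
  · intro y h1 h2
    obtain ⟨t, i, ht, rfl⟩ := (G.mem_dummies _ _ _).1 h2
    rcases List.mem_append.1 h1 with h1 | h1
    · obtain ⟨t', i', ht', -, hy⟩ := (G.mem_topDummies _ _ _).1 h1
      simp only [Sum.inr.injEq, Sigma.mk.injEq, heq_eq_eq, true_and] at hy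
      rw [hy.1] at ht
      omega
    · simp at h1

theorem nodup_listR' (G : HRLQInstance R H) (r : G.Resident') : (G.listR' r).Nodup := by
  match r with
  | Sum.inl r =>
    rw [listR', List.nodup_flatMap]
    refine ⟨fun s _ => (G.nodupR r).map (Prod.mk_left_injective s), ?_⟩
    refine (List.nodup_reverse.2 (List.nodup_finRange _)).imp ?_
    intro s t hst x hx hy
    simp only [List.mem_map] at hx hy
    obtain ⟨a, -, rfl⟩ := hx
    obtain ⟨b, -, hb⟩ := hy
    exact hst (Prod.ext_iff.1 hb).2.symm
  | Sum.inr ⟨h, s, i⟩ =>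
    rw [listR']
    split_ifs <;> simp

theorem mem_iff' (G : HRLQInstance R H) (r : G.Resident') (x : G.Hospital') :
    x ∈ G.listR' r ↔ r ∈ G.listH' x := by
  obtain ⟨h, s⟩ := x
  simp only [listH', List.mem_append, mem_topDummies, mem_dummies]
  match r with
  | Sum.inl r =>
    simp [listR', G.mem_iff]
  | Sum.inr ⟨h', t, i⟩ =>
    simp only [listR', List.mem_map, reduceCtorEq, and_false, exists_false, or_false]
    constructor
    · split_ifs with hc
      · intro hx
        simp only [List.mem_singleton, Prod.mk.injEq] at hx
        obtain ⟨rfl, rfl⟩ := hx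
        exact Or.inr ⟨t, i, rfl, rfl⟩
      · intro hx
        simp only [List.mem_cons, List.not_mem_nil, or_false, Prod.mk.injEq] at hx
        rcases hx with ⟨rfl, rfl⟩ | ⟨rfl, rfl⟩
        · exact Or.inr ⟨t, i, rfl, rfl⟩
        · exact Or.inl ⟨t, i, rfl, hc, rfl⟩
    · rintro (⟨t', i', ht, hc, he⟩ | ⟨t', i', ht, he⟩)
      · simp only [Sum.inr.injEq] at he
        cases he
        rw [if_neg hc]
        simp [Fin.ext_iff, ← ht]
      · simp only [Sum.inr.injEq] at he
        cases he
        split_ifs <;> simp [Fin.ext_iff, ← ht]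

/-- The reduced hospital residents instance `G'`. -/
def reduction (G : HRLQInstance R H) : HRInstance G.Resident' G.Hospital' where
  listR := G.listR'
  listH := G.listH'
  upper x := G.copyCap x.1 x.2
  nodupR := G.nodup_listR'
  nodupH := G.nodup_listH'
  mem_iff := G.mem_iff'

open Classical in
/-- `map(M')`: a resident is matched to `h` if and only if `M'` matches it to some copy of `h`. -/
noncomputable def mapBack [Fintype R] [DecidableEq R] [DecidableEq H] (G : HRLQInstance R H)
    (M' : Finset (G.Resident' × G.Hospital')) : Finset (R × H) :=
  Finset.univ.filter fun e => ∃ s : Fin G.numLevels, (Sum.inl e.1, (e.2, s)) ∈ M'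

end HRLQInstance

/-!
The cycle and path statements both follow from popularity.  A cycle or maximal path `ρ` of the
decomposition is a union of components of the graph of consecutive edges, because an edge has at
most one consecutive edge at each of its ends (`IsAltCycle.isComponentUnion`,
`IsAltPath.isComponentUnion`).  Switching `M` along such a `ρ` keeps the number of residents of each
hospital between the numbers for `M` and `N`, so `M ∆ ρ` is feasible
(`IsComponentUnion.isFeasible_symmDiff`) and cannot beat `M` if `M` is popular.

Popularity is a weak duality argument (`delta_nonpos_of_heights`) in which the height of a resident
is the level of the copy that it is matched to.  The copies of a hospital interact through the
dummies: the copy of level `s + 1` receives as many level-`s` dummies as there are residents at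
levels up to `s`, truncated at the capacity (`card_topAt`).  Hence, if `h` has a resident at level
`s + 1`, then its level-`s` copy still holds one of its own dummies, and it would accept any
neighbour (`slack_of_mem_succ`).  Stability then says that a resident `r` with an edge to `h` is at
most one level below any resident `x` of `h`; the votes of `r` and `h` for the edge `(r, h)`,
compared with `x`, add up to `-2` if `r` is one level below, to at most `0` at equal level, and
trivially to at most `2` otherwise, so they are at most twice the difference of the levels
(`voteR_add_vote_le`).  These bounds telescope over the pairs, independently of how the hospitals
choose them.  At the loose ends, a hospital that is not full has slack at level `1`, and a hospital
with more than `lower h` residents has them all at levels `0` and `1`.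

Feasibility of the image is a counting argument over the levels (`isFeasible_mapBack`), and a stable
matching exists by a fixed point argument (`HRInstance.exists_isStable`).
-/

/-! ### Preference lists and votes -/

section Preferences

theorem pair_sublist_or_pair_sublist {α : Type*} {l : List α} {a b : α} (ha : a ∈ l) (hb : b ∈ l)
    (hab : a ≠ b) : [a, b].Sublist l ∨ [b, a].Sublist l := by
  induction l with
  | nil => simp at ha
  | cons x l ih =>
    rcases List.mem_cons.1 ha with rfl | ha'
    · rcases List.mem_cons.1 hb with rfl | hb'
      · exact absurd rfl hab
      · exact Or.inl ((List.singleton_sublist.2 hb').cons_cons _)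
    · rcases List.mem_cons.1 hb with rfl | hb'
      · exact Or.inr ((List.singleton_sublist.2 ha').cons_cons _)
      · exact (ih ha' hb').imp (fun h => h.cons _) fun h => h.cons _

variable {α : Type*} [DecidableEq α]

theorem prefers_of_pair_sublist {l : List α} (hl : l.Nodup) {a b : α} (h : [a, b].Sublist l) :
    Prefers l (some a) (some b) := by
  refine ⟨h.subset (by simp), h.subset (by simp), ?_⟩
  induction l with
  | nil => simp at h
  | cons x l ih =>
    rcases List.nodup_cons.1 hl with ⟨hx, hl'⟩
    cases h with
    | cons _ h =>
      have ha : a ∈ l := h.subset (by simp)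
      have hb : b ∈ l := h.subset (by simp)
      rw [List.idxOf_cons_ne _ (by rintro rfl; exact hx ha),
        List.idxOf_cons_ne _ (by rintro rfl; exact hx hb)]
      exact Nat.succ_lt_succ (ih hl' h)
    | cons_cons _ h =>
      have hb : b ∈ l := List.singleton_sublist.1 h
      rw [List.idxOf_cons_self, List.idxOf_cons_ne _ (by rintro rfl; exact hx hb)]
      exact Nat.succ_pos _

theorem Prefers.asymm {l : List α} {x y : Option α} (h : Prefers l x y) : ¬ Prefers l y x := by
  cases x <;> cases y <;> simp_all [Prefers]
  omega

theorem Prefers.trans {l : List α} {a b c : α} (h : Prefers l (some a) (some b))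
    (h' : Prefers l (some b) (some c)) : Prefers l (some a) (some c) :=
  ⟨h.1, h'.2.1, h.2.2.trans h'.2.2⟩

theorem Prefers.ne {l : List α} {x y : Option α} (h : Prefers l x y) : x ≠ y := by
  rintro rfl
  exact h.asymm h

theorem prefers_or_prefers {l : List α} {a b : α} (ha : a ∈ l) (hb : b ∈ l) (hab : a ≠ b) :
    Prefers l (some a) (some b) ∨ Prefers l (some b) (some a) := by
  rcases lt_trichotomy (l.idxOf a) (l.idxOf b) with h | h | h
  · exact Or.inl ⟨ha, hb, h⟩
  · exact absurd ((List.idxOf_inj ha).1 h) hab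
  · exact Or.inr ⟨hb, ha, h⟩

/-- In a list without repetitions, preference is the relation "occurs before"; this reduces
preferences in concatenated and mapped lists to facts about sublists. -/
theorem prefers_iff_pair_sublist {l : List α} (hl : l.Nodup) {a b : α} :
    Prefers l (some a) (some b) ↔ [a, b].Sublist l := by
  refine ⟨fun h => ?_, prefers_of_pair_sublist hl⟩
  refine (pair_sublist_or_pair_sublist h.1 h.2.1 fun hab => h.ne (congrArg some hab)).resolve_right
    fun h' => h.asymm (prefers_of_pair_sublist hl h')

theorem prefers_append {l l' : List α} (hl : (l ++ l').Nodup) {a b : α} (ha : a ∈ l)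
    (hb : b ∈ l') : Prefers (l ++ l') (some a) (some b) :=
  prefers_of_pair_sublist hl
    ((List.singleton_sublist.2 ha).append (List.singleton_sublist.2 hb))

theorem vote_eq_one {l : List α} {x y : Option α} (h : Prefers l x y) : vote l x y = 1 :=
  if_pos h

theorem vote_eq_neg_one {l : List α} {x y : Option α} (h : Prefers l y x) : vote l x y = -1 := by
  rw [vote, if_neg h.asymm, if_pos h]

theorem vote_self (l : List α) (x : Option α) : vote l x x = 0 := by
  rw [vote, if_neg fun h => h.ne rfl, if_neg fun h => h.ne rfl]

theorem vote_le_one (l : List α) (x y : Option α) : vote l x y ≤ 1 := by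
  unfold vote
  split_ifs <;> simp

theorem vote_swap (l : List α) (x y : Option α) : vote l y x = - vote l x y := by
  by_cases h : Prefers l x y
  · rw [vote_eq_one h, vote_eq_neg_one h]
  · by_cases h' : Prefers l y x
    · rw [vote_eq_one h', vote_eq_neg_one h', neg_neg]
    · simp [vote, h, h']

end Preferences

/-! ### Matchings -/

section Matchings

theorem hospitalOf_eq_none_iff {R H : Type*} {M : Finset (R × H)} {r : R} :
    hospitalOf M r = none ↔ ∀ h, (r, h) ∉ M := by
  unfold hospitalOf
  split_ifs with hr
  · simpa using hr
  · simpa using hr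

variable {R H : Type*} [Fintype R] [DecidableEq R] [DecidableEq H]

@[simp]
theorem mem_residentsOf {M : Finset (R × H)} {h : H} {r : R} :
    r ∈ residentsOf M h ↔ (r, h) ∈ M := by
  simp [residentsOf]

namespace HRInstance

theorem IsMatching.hospitalOf_eq_some_iff {G : HRInstance R H} {M : Finset (R × H)}
    (hM : G.IsMatching M) {r : R} {h : H} : hospitalOf M r = some h ↔ (r, h) ∈ M := by
  unfold hospitalOf
  split_ifs with hr
  · rw [Option.some_inj]
    constructor
    · rintro rfl
      exact hr.choose_spec
    · exact fun h' => hM.resident _ _ _ hr.choose_spec h'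
  · simp only [false_iff]
    exact fun h' => hr ⟨h, h'⟩

/-- In a stable matching, a hospital that a resident `r` prefers to its own one is full and holds
nobody worse than `r`. -/
theorem IsStable.not_blocks {G : HRInstance R H} {M : Finset (R × H)} (hM : G.IsStable M)
    {r : R} {h : H} (hr : h ∈ G.listR r)
    (hp : Prefers (G.listR r) (some h) (hospitalOf M r)) :
    (residentsOf M h).card = G.upper h ∧
      ∀ r' ∈ residentsOf M h, ¬ Prefers (G.listH h) (some r) (some r') := by
  have := hM.2 r h
  constructor
  · refine le_antisymm (hM.1.hospital h) (not_lt.1 fun hlt => this ⟨hr, hp, Or.inl hlt⟩)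
  · exact fun r' hr' hpr => this ⟨hr, hp, Or.inr ⟨r', hr', hpr⟩⟩

/-! ### Existence of stable matchings -/

open Classical in
/-- Every hospital residents instance has a stable matching.  Residents reject all edges but the
best one of a set `X` of edges, hospitals reject all edges of a set `Y` that are preceded by
`upper h` better ones, and both rejection maps are monotone.  By the Knaster–Tarski theorem there
are sets `X`, `Y` such that `X` consists of the edges not rejected from `Y` and `Y` of those not
rejected from `X`; then `X ∩ Y` is stable. -/
theorem exists_isStable [Fintype H] (G : HRInstance R H) : ∃ M, G.IsStable M := by
  let E : Set (R × H) := {e | e.2 ∈ G.listR e.1}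
  let rejR : Set (R × H) → Set (R × H) := fun X =>
    {e | e ∈ X ∧ ∃ h', (e.1, h') ∈ X ∧ Prefers (G.listR e.1) (some h') (some e.2)}
  let better : Set (R × H) → R × H → Finset R := fun Y e =>
    Finset.univ.filter fun r' => (r', e.2) ∈ Y ∧ Prefers (G.listH e.2) (some r') (some e.1)
  let rejH : Set (R × H) → Set (R × H) := fun Y =>
    {e | e ∈ Y ∧ G.upper e.2 ≤ (better Y e).card}
  have hrejR : Monotone rejR := fun X X' hX e he =>
    ⟨hX he.1, he.2.imp fun _ h => ⟨hX h.1, h.2⟩⟩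
  have hrejH : Monotone rejH := fun Y Y' hY e he =>
    ⟨hY he.1, he.2.trans (Finset.card_le_card fun r' hr' => by
      simp only [better, Finset.mem_filter, Finset.mem_univ, true_and] at hr' ⊢
      exact ⟨hY hr'.1, hr'.2⟩)⟩
  let F : Set (R × H) →o Set (R × H) :=
    ⟨fun X => E \ rejH (E \ rejR X), fun X X' hX =>
      Set.sdiff_subset_sdiff_right (hrejH (Set.sdiff_subset_sdiff_right (hrejR hX)))⟩
  obtain ⟨X, hX⟩ : ∃ X, F X = X := ⟨F.lfp, F.map_lfp⟩
  obtain ⟨Y, hY⟩ : ∃ Y, Y = E \ rejR X := ⟨_, rfl⟩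
  replace hX : X = E \ rejH Y := by rw [hY]; exact hX.symm
  have memM : ∀ e, e ∈ X ∩ Y ↔ e ∈ Y ∧ (better Y e).card < G.upper e.2 := by
    intro e
    constructor
    · rintro ⟨h1, h2⟩
      rw [hX] at h1
      exact ⟨h2, not_le.1 fun h => h1.2 ⟨h2, h⟩⟩
    · rintro ⟨h1, h2⟩
      refine ⟨?_, h1⟩
      rw [hX]
      rw [hY] at h1
      exact ⟨h1.1, fun h => h.2.not_gt h2⟩
  -- a member of `Y` at `h` that is better than a member of `X ∩ Y` is itself in `X ∩ Y`
  have better_mono : ∀ r r' h, Prefers (G.listH h) (some r) (some r') →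
      better Y (r, h) ⊆ better Y (r', h) := by
    intro r r' h hr x hx
    simp only [better, Finset.mem_filter, Finset.mem_univ, true_and] at hx ⊢
    exact ⟨hx.1, hx.2.trans hr⟩
  let M : Finset (R × H) := (X ∩ Y).toFinset
  have hMm : ∀ e, e ∈ M ↔ e ∈ X ∩ Y := fun e => Set.mem_toFinset
  have hME : ∀ r h, (r, h) ∈ M → h ∈ G.listR r := by
    intro r h he
    have := ((hMm _).1 he).2
    rw [hY] at this
    exact this.1
  have hmatch : G.IsMatching M := by
    refine ⟨hME, fun r h₁ h₂ h1 h2 => ?_, fun h => ?_⟩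
    · by_contra hne
      have key : ∀ a b, (r, a) ∈ M → (r, b) ∈ M → ¬ Prefers (G.listR r) (some a) (some b) := by
        intro a b ha hb hab
        have hb' := ((hMm _).1 hb).2
        rw [hY] at hb'
        exact hb'.2 ⟨((hMm _).1 hb).1, a, ((hMm _).1 ha).1, hab⟩
      rcases prefers_or_prefers (hME _ _ h1) (hME _ _ h2) hne with hp | hp
      · exact key _ _ h1 h2 hp
      · exact key _ _ h2 h1 hp
    · rcases (residentsOf M h).eq_empty_or_nonempty with he | hne
      · simp [he]
      -- all other residents of `h` are better than the worst one
      obtain ⟨r, hr, hmax⟩ := Finset.exists_max_image _ (fun r => (G.listH h).idxOf r) hne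
      have hsub : (residentsOf M h).erase r ⊆ better Y (r, h) := by
        intro r' hr'
        rw [Finset.mem_erase, mem_residentsOf] at hr'
        simp only [better, Finset.mem_filter, Finset.mem_univ, true_and]
        refine ⟨((hMm _).1 hr'.2).2, ?_⟩
        have m1 := (G.mem_iff _ _).1 (hME _ _ (mem_residentsOf.1 hr))
        have m2 := (G.mem_iff _ _).1 (hME _ _ hr'.2)
        exact (prefers_or_prefers m2 m1 hr'.1).resolve_right fun hp =>
          (hmax r' (mem_residentsOf.2 hr'.2)).not_gt hp.2.2
      have h1 := Finset.card_le_card hsub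
      rw [Finset.card_erase_of_mem hr] at h1
      have h2 := ((memM _).1 ((hMm _).1 (mem_residentsOf.1 hr))).2
      simp only at h2
      omega
  refine ⟨M, hmatch, fun r h hb => ?_⟩
  obtain ⟨hE, hpr, hcap⟩ := hb
  have hnM : (r, h) ∉ M := fun hM => by
    rw [hmatch.hospitalOf_eq_some_iff.2 hM] at hpr
    exact hpr.ne rfl
  by_cases hYe : (r, h) ∈ Y
  · have hrej : G.upper h ≤ (better Y (r, h)).card := by
      by_contra hlt
      exact hnM ((hMm _).2 ((memM _).2 ⟨hYe, not_le.1 hlt⟩))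
    rcases hcap with hcap | ⟨r', hr', hp⟩
    · -- the residents that precede the best rejected one are all kept, and fill `h`
      obtain ⟨r₀, hr₀, hmin⟩ := Finset.exists_min_image
        (Finset.univ.filter fun r' => (r', h) ∈ Y ∧ G.upper h ≤ (better Y (r', h)).card)
        (fun r => (G.listH h).idxOf r) ⟨r, by simp [hYe, hrej]⟩
      simp only [Finset.mem_filter, Finset.mem_univ, true_and] at hr₀ hmin
      refine (hr₀.2.trans (Finset.card_le_card fun x hx => ?_)).not_gt hcap
      simp only [better, Finset.mem_filter, Finset.mem_univ, true_and] at hx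
      rw [mem_residentsOf, hMm, memM]
      exact ⟨hx.1, not_le.1 fun hle => (hmin x ⟨hx.1, hle⟩).not_gt hx.2.2.2⟩
    · have h1 := ((memM _).1 ((hMm _).1 (mem_residentsOf.1 hr'))).2
      exact (hrej.trans (Finset.card_le_card (better_mono _ _ _ hp))).not_gt h1
  · -- `r` rejected `h`, so its best edge in `X`, which lies in `M`, is better
    have hXr : (r, h) ∈ rejR X := by
      by_contra hn
      rw [hY] at hYe
      exact hYe ⟨hE, hn⟩
    obtain ⟨-, h', hh', hp'⟩ := hXr
    obtain ⟨h₀, hh₀, hmin⟩ := Finset.exists_min_image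
      (Finset.univ.filter fun h' => (r, h') ∈ X) (fun h => (G.listR r).idxOf h) ⟨h', by simpa⟩
    simp only [Finset.mem_filter, Finset.mem_univ, true_and] at hh₀ hmin
    have h₀E : h₀ ∈ G.listR r := by
      rw [hX] at hh₀
      exact hh₀.1
    have h₀M : (r, h₀) ∈ M := by
      rw [hMm]
      refine ⟨hh₀, ?_⟩
      rw [hY]
      exact ⟨h₀E, fun hrej => by
        obtain ⟨-, h'', hh'', hp''⟩ := hrej
        exact (hmin h'' hh'').not_gt hp''.2.2⟩
    rw [hmatch.hospitalOf_eq_some_iff.2 h₀M] at hpr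
    have := hmin h' hh'
    have h2 : (G.listR r).idxOf h < (G.listR r).idxOf h₀ := hpr.2.2
    have h3 : (G.listR r).idxOf h' < (G.listR r).idxOf h := hp'.2.2
    omega

end HRInstance

end Matchings

namespace HRLQInstance

/-! ### Correspondences -/

section Correspondences

variable {R H : Type*} [Fintype R] [DecidableEq R] [DecidableEq H] {G : HRLQInstance R H}
  {M N : Finset (R × H)}

/-- The paired residents on the two sides are in bijection, so any quantity that depends on the
pair only may be summed over either side. -/
theorem Correspondence.sum_paired (c : G.Correspondence) (hM : G.IsMatching M)
    (hN : G.IsMatching N) (h : H) (f : Option R → Option R → ℤ) :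
    ∑ r ∈ residentsOf M h \ residentsOf N h with c.corr h M N r ≠ none,
        f (some r) (c.corr h M N r) =
      ∑ r ∈ residentsOf N h \ residentsOf M h with c.corr h N M r ≠ none,
        f (c.corr h N M r) (some r) := by
  have key : ∀ {M N : Finset (R × H)}, G.IsMatching M → G.IsMatching N → ∀ r,
      ∀ hr : r ∈ (residentsOf M h \ residentsOf N h).filter fun r => c.corr h M N r ≠ none,
      (c.corr h M N r).get (Option.ne_none_iff_isSome.1 (Finset.mem_filter.1 hr).2) ∈
        residentsOf N h \ residentsOf M h ∧ c.corr h N M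
        ((c.corr h M N r).get (Option.ne_none_iff_isSome.1 (Finset.mem_filter.1 hr).2)) =
          some r := by
    intro M N hM hN r hr
    have hr' := (Finset.mem_filter.1 hr).1
    exact ⟨c.mem h M N hM hN r hr' _ (Option.some_get _).symm,
      c.symm h M N hM hN r hr' _ (Option.some_get _).symm⟩
  refine Finset.sum_bij'
    (fun r hr => (c.corr h M N r).get (Option.ne_none_iff_isSome.1 (Finset.mem_filter.1 hr).2))
    (fun r hr => (c.corr h N M r).get (Option.ne_none_iff_isSome.1 (Finset.mem_filter.1 hr).2))
    (fun r hr => ?_) (fun r hr => ?_) (fun r hr => ?_) (fun r hr => ?_) (fun r hr => ?_)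
  · exact Finset.mem_filter.2 ⟨(key hM hN r hr).1, by simp [(key hM hN r hr).2]⟩
  · exact Finset.mem_filter.2 ⟨(key hN hM r hr).1, by simp [(key hN hM r hr).2]⟩
  · simp [(key hM hN r hr).2]
  · simp [(key hN hM r hr).2]
  · simp only [(key hM hN r hr).2, Option.some_get]

theorem Correspondence.card_paired (c : G.Correspondence) (hM : G.IsMatching M)
    (hN : G.IsMatching N) (h : H) (f : Option R → Option R → Prop)
    [∀ a b, Decidable (f a b)] :
    (((residentsOf M h \ residentsOf N h).filter fun r => c.corr h M N r ≠ none).filter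
        fun r => f (some r) (c.corr h M N r)).card =
      (((residentsOf N h \ residentsOf M h).filter fun r => c.corr h N M r ≠ none).filter
        fun r => f (c.corr h N M r) (some r)).card := by
  have := c.sum_paired hM hN h fun a b => if f a b then 1 else 0
  simp only [Finset.sum_boole] at this
  exact_mod_cast this

/-- At a hospital with an unpaired resident on the side of `M`, all residents on the side of `N` are
paired, and `M` assigns more residents than `N`. -/
theorem Correspondence.card_lt_of_corr_eq_none (c : G.Correspondence) (hM : G.IsMatching M)
    (hN : G.IsMatching N) {h : H} {r : R} (hr : r ∈ residentsOf M h \ residentsOf N h)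
    (hc : c.corr h M N r = none) : (residentsOf N h).card < (residentsOf M h).card := by
  have h1 := c.card_paired hM hN h fun _ _ => True
  rw [Finset.filter_true, Finset.filter_true] at h1
  have h2 : (residentsOf N h \ residentsOf M h).filter (fun r => c.corr h N M r ≠ none) =
      residentsOf N h \ residentsOf M h :=
    Finset.filter_true_of_mem fun r' hr' => c.excess h M N hM hN r hr hc r' hr'
  rw [h2] at h1
  rw [← Finset.card_sdiff_lt_card_sdiff_iff, ← h1]
  exact Finset.card_lt_card (Finset.filter_ssubset.2 ⟨r, hr, by simpa using hc⟩)

theorem voteH_swap (c : G.Correspondence) (hM : G.IsMatching M) (hN : G.IsMatching N) (h : H) :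
    G.voteH c N M h = - G.voteH c M N h := by
  have split : ∀ (M N : Finset (R × H)), ∑ r ∈ residentsOf M h \ residentsOf N h,
      vote (G.listH h) (some r) (c.corr h M N r) =
      ∑ r ∈ residentsOf M h \ residentsOf N h with c.corr h M N r ≠ none,
        vote (G.listH h) (some r) (c.corr h M N r) -
      ∑ r ∈ residentsOf M h \ residentsOf N h with c.corr h M N r = none,
        vote (G.listH h) none (some r) := by
    intro M N
    rw [← Finset.sum_filter_add_sum_filter_not _ (fun r => c.corr h M N r = none), add_comm,
      sub_eq_add_neg, ← Finset.sum_neg_distrib]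
    refine congrArg₂ _ rfl (Finset.sum_congr rfl fun r hr => ?_)
    rw [(Finset.mem_filter.1 hr).2, vote_swap]
  have hp := c.sum_paired hM hN h fun a b => vote (G.listH h) a b
  have hn : ∑ r ∈ residentsOf N h \ residentsOf M h with c.corr h N M r ≠ none,
        vote (G.listH h) (c.corr h N M r) (some r) =
      - ∑ r ∈ residentsOf N h \ residentsOf M h with c.corr h N M r ≠ none,
        vote (G.listH h) (some r) (c.corr h N M r) := by
    rw [← Finset.sum_neg_distrib]
    exact Finset.sum_congr rfl fun r _ => vote_swap _ _ _
  rw [voteH, voteH, split M N, split N M]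
  linarith

theorem delta_swap [Fintype H] (c : G.Correspondence) (hM : G.IsMatching M)
    (hN : G.IsMatching N) : G.delta c N M = - G.delta c M N := by
  rw [delta, delta, neg_add, ← Finset.sum_neg_distrib, ← Finset.sum_neg_distrib]
  exact congrArg₂ _ (Finset.sum_congr rfl fun r _ => vote_swap _ _ _)
    (Finset.sum_congr rfl fun h _ => voteH_swap c hM hN h)

end Correspondences

/-! ### Components of the symmetric difference -/

section Components

variable {R H : Type*} [Fintype R] [DecidableEq R] [DecidableEq H] {G : HRLQInstance R H}
  {M N ρ : Finset (R × H)}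

/-- `ρ` is a union of components of the decomposition of `M ⊕ N`. -/
def IsComponentUnion (G : HRLQInstance R H) (c : G.Correspondence)
    (M N ρ : Finset (R × H)) : Prop :=
  ∀ e ∈ ρ, e ∈ M ∆ N ∧ ∀ g, (G.linkGraph c M N).Adj e g → g ∈ ρ

/-- Switching along a union of components changes the number of residents of a hospital only by
unpaired residents, which are all on the same side, so that the new number lies between the
numbers for `M` and `N`. -/
theorem IsComponentUnion.isFeasible_symmDiff {c : G.Correspondence}
    (hρ : G.IsComponentUnion c M N ρ) (hM : G.IsFeasible M) (hN : G.IsFeasible N) :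
    G.IsFeasible (M ∆ ρ) := by
  have mem : ∀ e, e ∈ M ∆ ρ → e ∈ M ∧ e ∉ ρ ∨ e ∈ ρ ∧ e ∈ N ∧ e ∉ M := by
    intro e he
    rcases Finset.mem_symmDiff.1 he with h | h
    · exact Or.inl h
    · have := Finset.mem_symmDiff.1 (hρ e h.1).1
      tauto
  have hcard : ∀ h, G.lower h ≤ (residentsOf (M ∆ ρ) h).card ∧
      (residentsOf (M ∆ ρ) h).card ≤ G.upper h := by
    intro h
    have hAB : (residentsOf (M ∆ ρ) h).card +
        ((residentsOf M h \ residentsOf N h).filter fun r => (r, h) ∈ ρ).card =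
        (residentsOf M h).card +
          ((residentsOf N h \ residentsOf M h).filter fun r => (r, h) ∈ ρ).card := by
      have hd : ∀ r, (r, h) ∈ ρ → (r, h) ∈ M ∧ (r, h) ∉ N ∨ (r, h) ∈ N ∧ (r, h) ∉ M :=
        fun r hr => Finset.mem_symmDiff.1 (hρ _ hr).1
      rw [← Finset.card_union_of_disjoint, ← Finset.card_union_of_disjoint]
      · congr 1
        ext r
        simp only [Finset.mem_union, mem_residentsOf, Finset.mem_filter, Finset.mem_sdiff,
          Finset.mem_symmDiff]
        have := hd r
        tauto
      · rw [Finset.disjoint_left]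
        intro r
        simp only [mem_residentsOf, Finset.mem_filter, Finset.mem_sdiff]
        tauto
      · rw [Finset.disjoint_left]
        intro r
        simp only [mem_residentsOf, Finset.mem_filter, Finset.mem_sdiff, Finset.mem_symmDiff]
        tauto
    have split : ∀ M N : Finset (R × H),
        ((residentsOf M h \ residentsOf N h).filter fun r => (r, h) ∈ ρ).card =
        (((residentsOf M h \ residentsOf N h).filter fun r => c.corr h M N r ≠ none).filter
          fun r => (r, h) ∈ ρ).card +
        (((residentsOf M h \ residentsOf N h).filter fun r => c.corr h M N r = none).filter
          fun r => (r, h) ∈ ρ).card := by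
      intro M N
      rw [← Finset.card_filter_add_card_filter_not (fun r => c.corr h M N r ≠ none),
        Finset.filter_comm]
      congr 2
      rw [Finset.filter_comm]
      simp
    have tot : ∀ M N : Finset (R × H), (residentsOf M h \ residentsOf N h).card =
        ((residentsOf M h \ residentsOf N h).filter fun r => c.corr h M N r ≠ none).card +
        ((residentsOf M h \ residentsOf N h).filter fun r => c.corr h M N r = none).card := by
      intro M N
      rw [← Finset.card_filter_add_card_filter_not (fun r => c.corr h M N r ≠ none)]
      simp
    have hpρ : (((residentsOf M h \ residentsOf N h).filter fun r => c.corr h M N r ≠ none).filter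
          fun r => (r, h) ∈ ρ).card =
        (((residentsOf N h \ residentsOf M h).filter fun r => c.corr h N M r ≠ none).filter
          fun r => (r, h) ∈ ρ).card := by
      have hp := c.card_paired hM.1 hN.1 h fun a _ => ∃ r, a = some r ∧ (r, h) ∈ ρ
      simp only [Option.some.injEq, exists_eq_left'] at hp
      rw [hp]
      congr 1
      refine Finset.filter_congr fun r hr => ?_
      obtain ⟨hr, hne⟩ := Finset.mem_filter.1 hr
      obtain ⟨x, hx⟩ := Option.ne_none_iff_exists'.1 hne
      have hxm := c.mem h N M hN.1 hM.1 r hr x hx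
      have hxs := c.symm h N M hN.1 hM.1 r hr x hx
      simp only [Finset.mem_sdiff, mem_residentsOf] at hr hxm
      have hadj : (G.linkGraph c M N).Adj (x, h) (r, h) :=
        Or.inl ⟨Finset.mem_sdiff.2 hxm, Finset.mem_sdiff.2 hr, Or.inr ⟨rfl, hxs⟩⟩
      rw [hx]
      simp only [Option.some.injEq, exists_eq_left']
      exact ⟨fun hx => (hρ _ hx).2 _ hadj, fun hr => (hρ _ hr).2 _ hadj.symm⟩
    have hp := c.card_paired hM.1 hN.1 h fun _ _ => True
    rw [Finset.filter_true, Finset.filter_true] at hp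
    have hone : ((residentsOf M h \ residentsOf N h).filter fun r => c.corr h M N r = none) = ∅ ∨
        ((residentsOf N h \ residentsOf M h).filter fun r => c.corr h N M r = none) = ∅ := by
      rw [or_iff_not_imp_left, ← ne_eq, ← Finset.nonempty_iff_ne_empty]
      rintro ⟨r, hr⟩
      obtain ⟨hr, hc⟩ := Finset.mem_filter.1 hr
      exact Finset.filter_false_of_mem fun r' hr' => c.excess h M N hM.1 hN.1 r hr hc r' hr'
    have hMN : (residentsOf M h).card + (residentsOf N h \ residentsOf M h).card =
        (residentsOf N h).card + (residentsOf M h \ residentsOf N h).card := by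
      rw [add_comm, Finset.card_sdiff_add_card, add_comm, Finset.card_sdiff_add_card,
        Finset.union_comm]
    have l1 := Finset.card_filter_le
      ((residentsOf M h \ residentsOf N h).filter fun r => c.corr h M N r = none)
      fun r => (r, h) ∈ ρ
    have l2 := Finset.card_filter_le
      ((residentsOf N h \ residentsOf M h).filter fun r => c.corr h N M r = none)
      fun r => (r, h) ∈ ρ
    rw [split M N, split N M] at hAB
    rw [tot M N, tot N M] at hMN
    have q1 := hM.2 h
    have q2 := hN.2 h
    have q3 := hM.1.hospital h
    have q4 := hN.1.hospital h
    rcases hone with h0 | h0 <;> rw [h0] at hMN hAB <;>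
      simp only [h0, Finset.filter_empty, Finset.card_empty] at hMN hAB l1 l2 <;> omega
  refine ⟨⟨fun r h he => ?_, fun r h₁ h₂ h1 h2 => ?_, fun h => (hcard h).2⟩,
    fun h => (hcard h).1⟩
  · rcases mem _ he with h | h
    · exact hM.1.edge _ _ h.1
    · exact hN.1.edge _ _ h.2.1
  · -- an edge of `M` outside `ρ` is not consecutive to an edge of `N` inside `ρ`
    have mixed : ∀ h₁ h₂, (r, h₁) ∈ M ∧ (r, h₁) ∉ ρ →
        (r, h₂) ∈ ρ ∧ (r, h₂) ∈ N ∧ (r, h₂) ∉ M → False := by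
      intro h₁ h₂ h1 h2
      by_cases hN1 : (r, h₁) ∈ N
      · obtain rfl := hN.1.resident _ _ _ hN1 h2.2.1
        exact h2.2.2 h1.1
      · refine h1.2 ((hρ _ h2.1).2 _ (Or.inr ⟨Finset.mem_sdiff.2 ⟨h1.1, hN1⟩,
          Finset.mem_sdiff.2 h2.2, Or.inl rfl⟩))
    rcases mem _ h1 with h1 | h1 <;> rcases mem _ h2 with h2 | h2
    · exact hM.1.resident _ _ _ h1.1 h2.1
    · exact (mixed _ _ h1 h2).elim
    · exact (mixed _ _ h2 h1).elim
    · exact hN.1.resident _ _ _ h1.2.1 h2.2.1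

theorem mem_symmDiff_of_adj {c : G.Correspondence} {e g : R × H}
    (h : (G.linkGraph c M N).Adj e g) : g ∈ M ∆ N := by
  rw [Finset.mem_symmDiff]
  rcases h with h | h
  · exact Or.inr (Finset.mem_sdiff.1 h.2.1)
  · exact Or.inl (Finset.mem_sdiff.1 h.1)

theorem fst_eq_or_snd_eq_of_adj {c : G.Correspondence} {e g : R × H}
    (h : (G.linkGraph c M N).Adj e g) : e.1 = g.1 ∨ e.2 = g.2 := by
  rcases h with h | h
  · exact h.2.2.imp id And.left
  · exact (h.2.2.imp id And.left).imp Eq.symm Eq.symm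

theorem eq_of_adj_of_fst_eq {c : G.Correspondence} (hM : G.IsMatching M) (hN : G.IsMatching N)
    {e g g' : R × H} (h : (G.linkGraph c M N).Adj e g) (h' : (G.linkGraph c M N).Adj e g')
    (hg : e.1 = g.1) (hg' : e.1 = g'.1) : g = g' := by
  refine Prod.ext (hg.symm.trans hg') ?_
  obtain ⟨r, h₁⟩ := g
  obtain ⟨r', h₂⟩ := g'
  obtain rfl : r = r' := hg.symm.trans hg'
  rcases h with h | h <;> rcases h' with h' | h'
  · exact hN.resident _ _ _ (Finset.mem_sdiff.1 h.2.1).1 (Finset.mem_sdiff.1 h'.2.1).1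
  · exact absurd (Finset.mem_sdiff.1 h.1).1 (Finset.mem_sdiff.1 h'.2.1).2
  · exact absurd (Finset.mem_sdiff.1 h'.1).1 (Finset.mem_sdiff.1 h.2.1).2
  · exact hM.resident _ _ _ (Finset.mem_sdiff.1 h.1).1 (Finset.mem_sdiff.1 h'.1).1

theorem eq_of_adj_of_snd_eq {c : G.Correspondence} (hM : G.IsMatching M) (hN : G.IsMatching N)
    {e g g' : R × H} (h : (G.linkGraph c M N).Adj e g) (h' : (G.linkGraph c M N).Adj e g')
    (hg : e.2 = g.2) (hg' : e.2 = g'.2) : g = g' := by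
  have key : ∀ {M N : Finset (R × H)}, G.IsMatching M → G.IsMatching N → ∀ {e g : R × H},
      e ∈ M \ N → g ∈ N \ M → e.2 = g.2 →
      (e.1 = g.1 ∨ e.2 = g.2 ∧ c.corr e.2 M N e.1 = some g.1) → c.corr e.2 M N e.1 = some g.1 := by
    intro M N hM hN e g he hg h2 h
    refine h.elim (fun h1 => ?_) And.right
    obtain rfl : e = g := Prod.ext h1 h2
    exact absurd (Finset.mem_sdiff.1 hg).1 (Finset.mem_sdiff.1 he).2
  have key' : ∀ {g : R × H}, g ∈ M \ N → e ∈ N \ M → e.2 = g.2 →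
      (g.1 = e.1 ∨ g.2 = e.2 ∧ c.corr g.2 M N g.1 = some e.1) →
        c.corr e.2 N M e.1 = some g.1 := by
    intro g hgm he h2 h
    have := key hM hN hgm he h2.symm h
    rw [← h2] at this
    refine c.symm e.2 M N hM hN g.1 ?_ e.1 this
    rw [Finset.mem_sdiff, mem_residentsOf, mem_residentsOf, h2]
    exact Finset.mem_sdiff.1 hgm
  refine Prod.ext ?_ (hg.symm.trans hg')
  rw [← Option.some_inj]
  rcases h with h | h <;> rcases h' with h' | h'
  · exact (key hM hN h.1 h.2.1 hg h.2.2).symm.trans (key hM hN h'.1 h'.2.1 hg' h'.2.2)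
  · exact absurd (Finset.mem_sdiff.1 h.1).1 (Finset.mem_sdiff.1 h'.2.1).2
  · exact absurd (Finset.mem_sdiff.1 h'.1).1 (Finset.mem_sdiff.1 h.2.1).2
  · exact (key' h.1 h.2.1 hg h.2.2).symm.trans (key' h'.1 h'.2.1 hg' h'.2.2)

/-- No edge has three consecutive edges, as it has at most one at each of its ends. -/
theorem eq_or_eq_of_adj {c : G.Correspondence} (hM : G.IsMatching M) (hN : G.IsMatching N)
    {e a b g : R × H} (ha : (G.linkGraph c M N).Adj e a) (hb : (G.linkGraph c M N).Adj e b)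
    (hg : (G.linkGraph c M N).Adj e g) (hab : a ≠ b) : g = a ∨ g = b := by
  rcases fst_eq_or_snd_eq_of_adj ha with ha' | ha' <;>
    rcases fst_eq_or_snd_eq_of_adj hb with hb' | hb' <;>
    rcases fst_eq_or_snd_eq_of_adj hg with hg' | hg'
  · exact absurd (eq_of_adj_of_fst_eq hM hN ha hb ha' hb') hab
  · exact absurd (eq_of_adj_of_fst_eq hM hN ha hb ha' hb') hab
  · exact Or.inl (eq_of_adj_of_fst_eq hM hN hg ha hg' ha')
  · exact Or.inr (eq_of_adj_of_snd_eq hM hN hg hb hg' hb')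
  · exact Or.inr (eq_of_adj_of_fst_eq hM hN hg hb hg' hb')
  · exact Or.inl (eq_of_adj_of_snd_eq hM hN hg ha hg' ha')
  · exact absurd (eq_of_adj_of_snd_eq hM hN ha hb ha' hb') hab
  · exact absurd (eq_of_adj_of_snd_eq hM hN ha hb ha' hb') hab

/-- An edge with an end-point has at most one consecutive edge. -/
theorem IsEndPoint.eq_of_adj {c : G.Correspondence} (hM : G.IsMatching M) (hN : G.IsMatching N)
    {e a g : R × H} {u : R ⊕ H} (hu : G.IsEndPoint c M N e u)
    (ha : (G.linkGraph c M N).Adj e a) (hg : (G.linkGraph c M N).Adj e g) : g = a := by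
  cases u with
  | inl r =>
    obtain ⟨rfl, hu⟩ := hu
    exact eq_of_adj_of_snd_eq hM hN hg ha
      ((fst_eq_or_snd_eq_of_adj hg).resolve_left fun h => hu g hg h.symm)
      ((fst_eq_or_snd_eq_of_adj ha).resolve_left fun h => hu a ha h.symm)
  | inr h =>
    obtain ⟨rfl, hu⟩ := hu
    exact eq_of_adj_of_fst_eq hM hN hg ha
      ((fst_eq_or_snd_eq_of_adj hg).resolve_right fun h => hu g hg h.symm)
      ((fst_eq_or_snd_eq_of_adj ha).resolve_right fun h => hu a ha h.symm)

theorem IsEndPoint.not_adj {c : G.Correspondence} {e g : R × H} {u v : R ⊕ H}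
    (hu : G.IsEndPoint c M N e u) (hv : G.IsEndPoint c M N e v) (huv : u ≠ v) :
    ¬ (G.linkGraph c M N).Adj e g := by
  intro hg
  cases u <;> cases v <;> obtain ⟨rfl, hu⟩ := hu <;> obtain ⟨rfl, hv⟩ := hv
  · exact huv rfl
  · exact (fst_eq_or_snd_eq_of_adj hg).elim (fun h => hu g hg h.symm) fun h => hv g hg h.symm
  · exact (fst_eq_or_snd_eq_of_adj hg).elim (fun h => hv g hg h.symm) fun h => hu g hg h.symm
  · exact huv rfl

/-- A vertex with two neighbours along a walk has no neighbours off that walk. -/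
theorem mem_support_of_ncard_eq_two {c : G.Correspondence} (hM : G.IsMatching M)
    (hN : G.IsMatching N) {a b e g : R × H} (p : (G.linkGraph c M N).Walk a b)
    (h2 : (p.toSubgraph.neighborSet e).ncard = 2) (hg : (G.linkGraph c M N).Adj e g) :
    g ∈ p.support := by
  obtain ⟨x, y, hxy, hs⟩ := Set.ncard_eq_two.1 h2
  have hx : p.toSubgraph.Adj e x := by
    rw [← SimpleGraph.Subgraph.mem_neighborSet, hs]
    simp
  have hy : p.toSubgraph.Adj e y := by
    rw [← SimpleGraph.Subgraph.mem_neighborSet, hs]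
    simp
  rw [← SimpleGraph.Walk.mem_verts_toSubgraph]
  rcases eq_or_eq_of_adj hM hN hx.adj_sub hy.adj_sub hg hxy with rfl | rfl
  · exact hx.snd_mem
  · exact hy.snd_mem

theorem IsAltCycle.isComponentUnion {c : G.Correspondence} (hM : G.IsMatching M)
    (hN : G.IsMatching N) (hρ : G.IsAltCycle c M N ρ) : G.IsComponentUnion c M N ρ := by
  obtain ⟨e, p, hp, rfl⟩ := hρ
  intro w hw
  rw [List.mem_toFinset] at hw
  have h2 := hp.ncard_neighborSet_toSubgraph_eq_two hw
  refine ⟨?_, fun g hg => List.mem_toFinset.2 (mem_support_of_ncard_eq_two hM hN p h2 hg)⟩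
  obtain ⟨x, y, hxy, hs⟩ := Set.ncard_eq_two.1 h2
  have hx : p.toSubgraph.Adj w x := by
    rw [← SimpleGraph.Subgraph.mem_neighborSet, hs]
    simp
  exact mem_symmDiff_of_adj hx.adj_sub.symm

theorem IsAltPath.isComponentUnion {c : G.Correspondence} (hM : G.IsMatching M)
    (hN : G.IsMatching N) {e f : R × H} {u v : R ⊕ H} (hρ : G.IsAltPath c M N ρ e f u v) :
    G.IsComponentUnion c M N ρ := by
  obtain ⟨he, hu, hv, huv, p, hp, rfl⟩ := hρ
  have hsupp : ∀ {e f : R × H} (p : (G.linkGraph c M N).Walk e f), e ∈ M ∆ N →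
      ∀ w ∈ p.support, w ∈ M ∆ N := by
    intro e f p
    induction p with
    | nil => simp
    | cons hadj p ih =>
      intro he w hw
      rw [SimpleGraph.Walk.support_cons, List.mem_cons] at hw
      rcases hw with rfl | hw
      · exact he
      · exact ih (mem_symmDiff_of_adj hadj) w hw
  intro w hw
  rw [List.mem_toFinset] at hw
  refine ⟨hsupp p he w hw, fun g hg => List.mem_toFinset.2 ?_⟩
  by_cases hnil : p.Nil
  · obtain rfl := hnil.eq
    rw [SimpleGraph.Walk.nil_iff_support_eq.1 hnil, List.mem_singleton] at hw
    subst hw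
    exact absurd hg (hu.not_adj hv (huv rfl))
  obtain ⟨i, rfl, hi⟩ := SimpleGraph.Walk.mem_support_iff_exists_getVert.1 hw
  rcases Nat.eq_zero_or_pos i with rfl | hi0
  · rw [SimpleGraph.Walk.getVert_zero] at hg
    rw [hu.eq_of_adj hM hN (p.adj_snd hnil) hg]
    exact p.getVert_mem_support 1
  rcases hi.eq_or_lt with rfl | hlt
  · rw [SimpleGraph.Walk.getVert_length] at hg
    rw [hv.eq_of_adj hM hN (p.adj_penultimate hnil).symm hg]
    exact p.getVert_mem_support _
  · exact mem_support_of_ncard_eq_two hM hN p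
      (hp.ncard_neighborSet_toSubgraph_internal_eq_two hi0.ne' hlt) hg

end Components

end HRLQInstance

namespace HRLQInstance

/-! ### A witness for popularity -/

section Witness

variable {R H : Type*} [Fintype R] [DecidableEq R] [Fintype H] [DecidableEq H]
  {G : HRLQInstance R H} {M N : Finset (R × H)}

/-- A weak duality argument: heights `t` of the residents bound the votes of all pairs of edges of
`N` and `M` at the hospitals, and this shows that `N` does not win against `M`.  Each pair `(r, x)`
contributes `2 * (t r - t x)`, an unfilled position of `M` counts as height `1`, and an unfilled
position of `N` has a resident of height at most `1` opposite to it.  Adding `1` for each edge of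
`N \ M` and `-1` for each edge of `M \ N` makes the contribution of every hospital nonpositive, and
the remaining contribution of every resident is nonpositive as well. -/
theorem delta_nonpos_of_heights (c : G.Correspondence) (hM : G.IsMatching M) (hN : G.IsMatching N)
    (t : R → ℤ)
    (pair : ∀ h r x, (r, h) ∈ N → (r, h) ∉ M → (x, h) ∈ M → (x, h) ∉ N →
      G.voteR N M r + vote (G.listH h) (some r) (some x) ≤ 2 * (t r - t x))
    (excessN : ∀ h r, (r, h) ∈ N → (r, h) ∉ M →
      (residentsOf M h).card < (residentsOf N h).card → G.voteR N M r + 1 ≤ 2 * (t r - 1))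
    (excessM : ∀ h x, (x, h) ∈ M → (x, h) ∉ N →
      (residentsOf N h).card < (residentsOf M h).card → t x ≤ 1)
    (nonneg : ∀ r, 0 ≤ t r) (unmatched : ∀ r, hospitalOf M r = none → t r = 0) :
    G.delta c N M ≤ 0 := by
  have hospital : ∀ h,
      ∑ r ∈ residentsOf N h \ residentsOf M h, (G.voteR N M r - 2 * t r + 1) +
        ∑ x ∈ residentsOf M h \ residentsOf N h, (2 * t x - 1) + G.voteH c N M h ≤ 0 := by
    intro h
    have hp := c.sum_paired hM hN h fun a _ => a.elim 0 fun x => 2 * t x - 1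
    simp only [Option.elim_some] at hp
    have hMs := Finset.sum_filter_add_sum_filter_not (residentsOf M h \ residentsOf N h)
      (fun r => c.corr h M N r = none) fun x => 2 * t x - 1
    have hNs := Finset.sum_filter_add_sum_filter_not (residentsOf N h \ residentsOf M h)
      (fun r => c.corr h N M r = none) fun r => G.voteR N M r - 2 * t r + 1 +
        vote (G.listH h) (some r) (c.corr h N M r)
    have hNt := Finset.sum_add_distrib (s := residentsOf N h \ residentsOf M h)
      (f := fun r => G.voteR N M r - 2 * t r + 1)
      (g := fun r => vote (G.listH h) (some r) (c.corr h N M r))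
    have h1 : ∑ r ∈ residentsOf N h \ residentsOf M h with c.corr h N M r ≠ none,
        (G.voteR N M r - 2 * t r + 1 + vote (G.listH h) (some r) (c.corr h N M r)) +
        ∑ r ∈ residentsOf N h \ residentsOf M h with c.corr h N M r ≠ none,
          (c.corr h N M r).elim 0 (fun x => 2 * t x - 1) ≤ 0 := by
      rw [← Finset.sum_add_distrib]
      refine Finset.sum_nonpos fun r hr => ?_
      obtain ⟨hr, hne⟩ := Finset.mem_filter.1 hr
      obtain ⟨x, hx⟩ := Option.ne_none_iff_exists'.1 hne
      have hxm := c.mem h N M hN hM r hr x hx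
      simp only [Finset.mem_sdiff, mem_residentsOf] at hr hxm
      have := pair h r x hr.1 hr.2 hxm.1 hxm.2
      rw [hx, Option.elim_some]
      linarith
    have h2 : ∑ r ∈ residentsOf N h \ residentsOf M h with c.corr h N M r = none,
        (G.voteR N M r - 2 * t r + 1 + vote (G.listH h) (some r) (c.corr h N M r)) ≤ 0 := by
      refine Finset.sum_nonpos fun r hr => ?_
      obtain ⟨hr, hc⟩ := Finset.mem_filter.1 hr
      have hlt := c.card_lt_of_corr_eq_none hN hM hr hc
      simp only [Finset.mem_sdiff, mem_residentsOf] at hr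
      have := excessN h r hr.1 hr.2 hlt
      have := vote_le_one (G.listH h) (some r) (c.corr h N M r)
      linarith
    have h3 : ∑ x ∈ residentsOf M h \ residentsOf N h with c.corr h M N x = none,
        (2 * t x - 1) +
        ∑ x ∈ residentsOf M h \ residentsOf N h with c.corr h M N x = none,
          vote (G.listH h) none (some x) ≤ 0 := by
      rw [← Finset.sum_add_distrib]
      refine Finset.sum_nonpos fun x hx => ?_
      obtain ⟨hx, hc⟩ := Finset.mem_filter.1 hx
      have hlt := c.card_lt_of_corr_eq_none hM hN hx hc
      simp only [Finset.mem_sdiff, mem_residentsOf] at hx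
      have := excessM h x hx.1 hx.2 hlt
      rw [vote_eq_neg_one (show Prefers _ (some x) none from
        (G.mem_iff _ _).1 (hM.edge _ _ hx.1))]
      linarith
    simp only [ne_eq] at hp hMs hNs h1
    rw [voteH]
    linarith
  have resident : ∀ r, G.voteR N M r ≤
      ∑ h, ((if (r, h) ∈ N ∧ (r, h) ∉ M then G.voteR N M r - 2 * t r + 1 else 0) +
        if (r, h) ∈ M ∧ (r, h) ∉ N then 2 * t r - 1 else 0) := by
    intro r
    have single : ∀ {A : Finset (R × H)} (B : Finset (R × H)), G.IsMatching A → ∀ h, (r, h) ∈ A →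
        ∀ z : ℤ, ∑ h', (if (r, h') ∈ A ∧ (r, h') ∉ B then z else 0) =
          if (r, h) ∉ B then z else 0 := by
      intro A B hA h hh z
      rw [Finset.sum_eq_single h]
      · simp [hh]
      · intro h' _ hne
        exact if_neg fun h'' => hne (hA.resident _ _ _ h''.1 hh)
      · simp
    have zero : ∀ {A : Finset (R × H)} (B : Finset (R × H)), hospitalOf A r = none →
        ∀ z : ℤ, ∑ h', (if (r, h') ∈ A ∧ (r, h') ∉ B then z else 0) = 0 := by
      intro A B hA z
      exact Finset.sum_eq_zero fun h' _ => if_neg fun h'' => hospitalOf_eq_none_iff.1 hA h' h''.1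
    rw [Finset.sum_add_distrib]
    have h0 := nonneg r
    rcases hMr : hospitalOf M r with _ | h₁ <;> rcases hNr : hospitalOf N r with _ | h₂
    · rw [zero M hNr, zero N hMr, voteR, hMr, hNr, vote_self, add_zero]
    · have hN2 := hN.hospitalOf_eq_some_iff.1 hNr
      rw [single M hN h₂ hN2, zero N hMr, unmatched r hMr,
        if_pos (hospitalOf_eq_none_iff.1 hMr h₂)]
      linarith
    · have hM1 := hM.hospitalOf_eq_some_iff.1 hMr
      rw [zero M hNr, single N hM h₁ hM1, if_pos (hospitalOf_eq_none_iff.1 hNr h₁), voteR, hMr, hNr,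
        vote_eq_neg_one (show Prefers _ (some h₁) none from hM.edge _ _ hM1)]
      linarith
    · have hM1 := hM.hospitalOf_eq_some_iff.1 hMr
      have hN2 := hN.hospitalOf_eq_some_iff.1 hNr
      rw [single M hN h₂ hN2, single N hM h₁ hM1]
      by_cases heq : h₁ = h₂
      · subst heq
        rw [if_neg (not_not.2 hM1), if_neg (not_not.2 hN2), voteR, hMr, hNr, vote_self, add_zero]
      · rw [if_pos fun h => heq (hM.resident _ _ _ hM1 h),
          if_pos fun h => heq (hN.resident _ _ _ h hN2)]
        linarith
  have swap : ∑ r, ∑ h, ((if (r, h) ∈ N ∧ (r, h) ∉ M then G.voteR N M r - 2 * t r + 1 else 0) +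
        if (r, h) ∈ M ∧ (r, h) ∉ N then 2 * t r - 1 else 0) =
      ∑ h, (∑ r ∈ residentsOf N h \ residentsOf M h, (G.voteR N M r - 2 * t r + 1) +
        ∑ x ∈ residentsOf M h \ residentsOf N h, (2 * t x - 1)) := by
    rw [Finset.sum_comm]
    refine Finset.sum_congr rfl fun h _ => ?_
    have conv : ∀ (A B : Finset (R × H)) (f : R → ℤ), ∑ r ∈ residentsOf A h \ residentsOf B h, f r =
        ∑ r, if (r, h) ∈ A ∧ (r, h) ∉ B then f r else 0 := by
      intro A B f
      rw [← Finset.sum_filter]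
      refine Finset.sum_congr ?_ fun _ _ => rfl
      ext r
      simp
    rw [conv, conv, Finset.sum_add_distrib]
  have := Finset.sum_le_sum fun r (_ : r ∈ Finset.univ) => resident r
  rw [swap] at this
  have h' := Finset.sum_nonpos fun h (_ : h ∈ Finset.univ) => hospital h
  rw [Finset.sum_add_distrib] at h'
  rw [delta]
  linarith

end Witness

end HRLQInstance

namespace HRLQInstance

/-! ### Preferences in the reduced instance -/

section ReducedLists

variable {R H : Type*} [Fintype H] (G : HRLQInstance R H)

theorem two_le_numLevels : 2 ≤ G.numLevels := Nat.le_add_right _ _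

theorem mem_listR'_inl {r : R} {h : H} {s : Fin G.numLevels} :
    (h, s) ∈ G.listR' (Sum.inl r) ↔ h ∈ G.listR r := by
  simp [listR']

theorem topDummies_succ (h : H) (s : ℕ) : G.topDummies h (s + 1) =
    (G.dummies h s).drop (G.copyCap h s - G.copyCap h (s + 1)) := by
  match s with
  | 0 => simp [topDummies, copyCap]
  | 1 => simp [topDummies, copyCap]
  | s + 2 => simp [topDummies, copyCap]

theorem topDummies_succ_subset (h : H) (s : ℕ) : G.topDummies h (s + 1) ⊆ G.dummies h s := by
  rw [topDummies_succ]
  exact List.drop_subset _ _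

theorem length_dummies (h : H) {s : ℕ} (hs : s + 1 < G.numLevels) :
    (G.dummies h s).length = G.copyCap h s := by
  rw [dummies, dif_pos (by omega)]
  simp

theorem copyCap_succ_le {R H : Type*} (G : HRLQInstance R H) {h : H}
    (hq : G.lower h ≤ G.upper h) (s : ℕ) :
    G.copyCap h (s + 1) ≤ G.copyCap h s := by
  unfold copyCap
  split_ifs <;> omega

theorem length_topDummies {h : H} (hq : G.lower h ≤ G.upper h) {s : ℕ}
    (hs : s + 1 < G.numLevels) : (G.topDummies h (s + 1)).length = G.copyCap h (s + 1) := by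
  rw [topDummies_succ, List.length_drop, G.length_dummies h hs]
  have := G.copyCap_succ_le hq s
  omega

theorem listR'_of_mem_dummies {d : G.Resident'} {h : H} {s : ℕ} (hs : s < G.numLevels)
    (hd : d ∈ G.dummies h s) : ∃ l, G.listR' d = (h, ⟨s, hs⟩) :: l := by
  obtain ⟨t, i, rfl, rfl⟩ := (G.mem_dummies _ _ _).1 hd
  rw [listR']
  split_ifs
  · exact ⟨_, rfl⟩
  · exact ⟨_, rfl⟩

theorem listR'_of_mem_topDummies {d : G.Resident'} {h : H} {s : ℕ} (hs : s + 1 < G.numLevels)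
    (hd : d ∈ G.topDummies h (s + 1)) :
    G.listR' d = [(h, ⟨s, by omega⟩), (h, ⟨s + 1, hs⟩)] := by
  obtain ⟨t, i, ht, hc, rfl⟩ := (G.mem_topDummies _ _ _).1 hd
  obtain rfl : (t : ℕ) = s := by omega
  rw [listR', if_neg hc]

variable [DecidableEq H]

theorem prefers_listR'_of_lt {r : R} {h h' : H} {s s' : Fin G.numLevels} (hh : h ∈ G.listR r)
    (hh' : h' ∈ G.listR r) (hs : s' < s) :
    Prefers (G.listR' (Sum.inl r)) (some (h, s)) (some (h', s')) := by
  refine prefers_of_pair_sublist (G.nodup_listR' _) ?_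
  have h1 : [s, s'].Sublist (List.finRange G.numLevels).reverse := by
    refine (pair_sublist_or_pair_sublist (by simp) (by simp) hs.ne').resolve_right fun h => ?_
    have := (List.pairwise_reverse.2 (List.pairwise_lt_finRange G.numLevels)).sublist h
    simp only [List.pairwise_cons, List.mem_singleton, forall_eq] at this
    exact this.1.not_gt hs
  refine List.Sublist.trans ?_ (h1.flatMap fun s => (G.listR r).map fun h => (h, s))
  simp only [List.flatMap_cons, List.flatMap_nil, List.append_nil]
  have h2 : ∀ (t : Fin G.numLevels) (k : H), k ∈ G.listR r →
      [(k, t)].Sublist ((G.listR r).map fun h => (h, t)) :=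
    fun t k hk => List.singleton_sublist.2 (List.mem_map.2 ⟨k, hk, rfl⟩)
  exact (h2 s h hh).append (h2 s' h' hh')

theorem prefers_listR'_of_prefers {r : R} {h h' : H} (s : Fin G.numLevels)
    (hp : Prefers (G.listR r) (some h) (some h')) :
    Prefers (G.listR' (Sum.inl r)) (some (h, s)) (some (h', s)) := by
  refine prefers_of_pair_sublist (G.nodup_listR' _) ?_
  refine (((prefers_iff_pair_sublist (G.nodupR r)).1 hp).map fun h => (h, s)).trans ?_
  have h1 : [s].Sublist (List.finRange G.numLevels).reverse :=
    List.singleton_sublist.2 (by simp)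
  have h2 := h1.flatMap fun s => (G.listR r).map fun h => (h, s)
  rwa [List.flatMap_singleton] at h2

variable [DecidableEq R]

theorem prefers_listH'_inl {r r' : R} {h : H} (s : Fin G.numLevels)
    (hp : Prefers (G.listH h) (some r) (some r')) :
    Prefers (G.listH' (h, s)) (some (Sum.inl r)) (some (Sum.inl r')) := by
  refine prefers_of_pair_sublist (G.nodup_listH' _) ?_
  refine (((prefers_iff_pair_sublist (G.nodupH h)).1 hp).map Sum.inl).trans ?_
  exact (List.sublist_append_right _ _).trans (List.sublist_append_left _ _)

theorem prefers_listH'_inl_dummy {r : R} {d : G.Resident'} {h : H} {s : Fin G.numLevels}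
    (hr : r ∈ G.listH h) (hd : d ∈ G.dummies h s) :
    Prefers (G.listH' (h, s)) (some (Sum.inl r)) (some d) :=
  prefers_append (G.nodup_listH' _) (List.mem_append_right _ (List.mem_map_of_mem hr)) hd

theorem prefers_listH'_topDummy {d x : G.Resident'} {h : H} {s : Fin G.numLevels}
    (hd : d ∈ G.topDummies h s) (hx : x ∈ G.listH' (h, s)) (hx' : x ∉ G.topDummies h s) :
    Prefers (G.listH' (h, s)) (some d) (some x) := by
  have e : G.listH' (h, s) =
      G.topDummies h s ++ ((G.listH h).map Sum.inl ++ G.dummies h s) := by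
    rw [listH', List.append_assoc]
  have hn := G.nodup_listH' (h, s)
  rw [e] at hx hn ⊢
  exact prefers_append hn hd ((List.mem_append.1 hx).resolve_left hx')

/-- A level-`s` dummy without an edge to the copy of level `s + 1` comes before all those with such
an edge. -/
theorem prefers_listH'_dummy {d d' : G.Resident'} {h : H} {s : Fin G.numLevels}
    (hd : d ∈ G.dummies h s) (hd1 : d ∉ G.topDummies h (s + 1))
    (hd' : d' ∈ G.topDummies h (s + 1)) :
    Prefers (G.listH' (h, s)) (some d) (some d') := by
  have e := List.take_append_drop (G.copyCap h s - G.copyCap h (s + 1)) (G.dummies h s)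
  rw [← G.topDummies_succ h s] at e
  refine prefers_of_pair_sublist (G.nodup_listH' _) (List.Sublist.trans ?_
    (List.sublist_append_right _ _))
  rw [← e] at hd ⊢
  exact (List.singleton_sublist.2 ((List.mem_append.1 hd).resolve_right hd1)).append
    (List.singleton_sublist.2 hd')

end ReducedLists

/-! ### Stable matchings of the reduced instance -/

section Reduction

section Levels

variable {R H : Type*} [Fintype R] [Fintype H] {G : HRLQInstance R H}
  {M' : Finset (G.Resident' × G.Hospital')}

open Classical in
/-- The residents at the level-`s` copy of `h`, for any natural number `s`. -/
noncomputable def atLevel (G : HRLQInstance R H)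
    (M' : Finset (G.Resident' × G.Hospital')) (h : H) (s : ℕ) :
    Finset G.Resident' :=
  Finset.univ.filter fun x => ∃ hs : s < G.numLevels, (x, (h, ⟨s, hs⟩)) ∈ M'

theorem mem_atLevel {h : H} {s : ℕ} {x : G.Resident'} : x ∈ G.atLevel M' h s ↔
    ∃ hs : s < G.numLevels, (x, (h, (⟨s, hs⟩ : Fin G.numLevels))) ∈ M' := by
  simp [atLevel]

open Classical in
/-- The residents of the original instance at the level-`s` copy of `h`. -/
noncomputable def realAt (G : HRLQInstance R H)
    (M' : Finset (G.Resident' × G.Hospital')) (h : H) (s : ℕ) :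
    Finset R :=
  Finset.univ.filter fun r => Sum.inl r ∈ G.atLevel M' h s

open Classical in
/-- The level-`(s-1)` dummies at the level-`s` copy of `h`. -/
noncomputable def topAt (G : HRLQInstance R H)
    (M' : Finset (G.Resident' × G.Hospital')) (h : H) (s : ℕ) :
    Finset G.Resident' :=
  (G.atLevel M' h s).filter fun x => x ∈ G.topDummies h s

open Classical in
/-- The level-`s` dummies at the level-`s` copy of `h`. -/
noncomputable def ownAt (G : HRLQInstance R H)
    (M' : Finset (G.Resident' × G.Hospital')) (h : H) (s : ℕ) :
    Finset G.Resident' :=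
  (G.atLevel M' h s).filter fun x => x ∈ G.dummies h s

theorem mem_realAt {h : H} {s : ℕ} {r : R} :
    r ∈ G.realAt M' h s ↔ Sum.inl r ∈ G.atLevel M' h s := by
  simp [realAt]

theorem mem_topAt {h : H} {s : ℕ} {x : G.Resident'} :
    x ∈ G.topAt M' h s ↔ x ∈ G.atLevel M' h s ∧ x ∈ G.topDummies h s := by
  simp [topAt]

theorem mem_ownAt {h : H} {s : ℕ} {x : G.Resident'} :
    x ∈ G.ownAt M' h s ↔ x ∈ G.atLevel M' h s ∧ x ∈ G.dummies h s := by
  simp [ownAt]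

theorem topAt_zero (h : H) : G.topAt M' h 0 = ∅ :=
  Finset.eq_empty_iff_forall_notMem.2 fun x hx => by simpa [topDummies] using (mem_topAt.1 hx).2

/-- The number of residents of the original instance at the copies of `h` of levels below `s`. -/
noncomputable def realBelow (G : HRLQInstance R H) (M' : Finset (G.Resident' × G.Hospital')) (h : H)
    (s : ℕ) : ℕ :=
  ∑ t ∈ Finset.range s, (G.realAt M' h t).card

theorem realBelow_succ (h : H) (s : ℕ) :
    G.realBelow M' h (s + 1) = G.realBelow M' h s + (G.realAt M' h s).card :=
  Finset.sum_range_succ _ _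

theorem realBelow_mono (h : H) : Monotone (G.realBelow M' h) :=
  fun _ _ hst => Finset.sum_le_sum_of_subset (Finset.range_subset_range.2 hst)

end Levels

variable {R H : Type*} [Fintype R] [DecidableEq R] [Fintype H] [DecidableEq H]
  {G : HRLQInstance R H} {M' : Finset (G.Resident' × G.Hospital')}

theorem mem_mapBack {r : R} {h : H} :
    (r, h) ∈ G.mapBack M' ↔ ∃ s : Fin G.numLevels, (Sum.inl r, (h, s)) ∈ M' := by
  simp [mapBack]

/-- A copy of a hospital has slack if it is not full or holds one of the dummies at the end of its
list; it would then accept every neighbour in the original instance. -/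
def Slack (G : HRLQInstance R H) (M' : Finset (G.Resident' × G.Hospital'))
    (x : G.Hospital') : Prop :=
  (residentsOf M' x).card < G.copyCap x.1 x.2 ∨ ∃ d ∈ residentsOf M' x, d ∈ G.dummies x.1 x.2

/-- A neighbour of a hospital with slack at level `s` is matched at least as well as to this copy:
at a higher level, or at level `s` to a hospital that is not worse. -/
theorem Slack.exists_mem (hM' : G.reduction.IsStable M') {r : R} {h : H} {s : Fin G.numLevels}
    (hs : G.Slack M' (h, s)) (hr : h ∈ G.listR r) :
    ∃ h' s', (Sum.inl r, (h', s')) ∈ M' ∧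
      (s < s' ∨ s = s' ∧ (h' = h ∨ Prefers (G.listR r) (some h') (some h))) := by
  have nb : ¬ Prefers (G.listR' (Sum.inl r)) (some (h, s)) (hospitalOf M' (Sum.inl r)) := by
    intro hp
    obtain ⟨h1, h2⟩ := hM'.not_blocks (G.mem_listR'_inl.2 hr) hp
    rcases hs with hs | ⟨d, hd, hd'⟩
    · exact hs.ne h1
    · exact h2 d hd (G.prefers_listH'_inl_dummy ((G.mem_iff _ _).1 hr) hd')
  rcases hx : hospitalOf M' (Sum.inl r) with _ | ⟨h', s'⟩
  · rw [hx] at nb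
    exact absurd (G.mem_listR'_inl.2 hr) nb
  · have hm := hM'.1.hospitalOf_eq_some_iff.1 hx
    have hr' : h' ∈ G.listR r := G.mem_listR'_inl.1 (hM'.1.edge _ _ hm)
    rw [hx] at nb
    refine ⟨h', s', hm, ?_⟩
    rcases lt_trichotomy s s' with hlt | rfl | hlt
    · exact Or.inl hlt
    · refine Or.inr ⟨rfl, or_iff_not_imp_left.2 fun hne => ?_⟩
      exact (prefers_or_prefers hr' hr hne).resolve_right fun hp =>
        nb (G.prefers_listR'_of_prefers s hp)
    · exact absurd (G.prefers_listR'_of_lt hr hr' hlt) nb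

theorem atLevel_eq_residentsOf {h : H} {s : ℕ} (hs : s < G.numLevels) :
    G.atLevel M' h s = residentsOf M' (h, (⟨s, hs⟩ : Fin G.numLevels)) := by
  ext x
  simp [mem_atLevel, hs]

theorem eq_of_mem_atLevel (hM' : G.reduction.IsMatching M') {h : H} {s s' : ℕ} {x : G.Resident'}
    (hx : x ∈ G.atLevel M' h s) (hx' : x ∈ G.atLevel M' h s') : s = s' := by
  obtain ⟨hs, h1⟩ := mem_atLevel.1 hx
  obtain ⟨hs', h2⟩ := mem_atLevel.1 hx'
  have := hM'.resident _ _ _ h1 h2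
  simpa using this

theorem card_atLevel_le (hM' : G.reduction.IsMatching M') (h : H) {s : ℕ}
    (hs : s < G.numLevels) : (G.atLevel M' h s).card ≤ G.copyCap h s := by
  rw [atLevel_eq_residentsOf hs]
  exact hM'.hospital _

theorem mem_listH'_of_mem_atLevel (hM' : G.reduction.IsMatching M') {h : H} {s : ℕ}
    {x : G.Resident'} (hx : x ∈ G.atLevel M' h s) :
    x ∈ G.topDummies h s ++ (G.listH h).map Sum.inl ++ G.dummies h s := by
  obtain ⟨hs, hx⟩ := mem_atLevel.1 hx
  exact (G.mem_iff' _ _).1 (hM'.edge _ _ hx)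

theorem card_atLevel (hM' : G.reduction.IsMatching M') (h : H) (s : ℕ) :
    (G.atLevel M' h s).card =
      (G.topAt M' h s).card + (G.realAt M' h s).card + (G.ownAt M' h s).card := by
  rw [← Finset.card_map (s := G.realAt M' h s) Function.Embedding.inl,
    ← Finset.card_union_of_disjoint, ← Finset.card_union_of_disjoint]
  · congr 1
    ext x
    simp only [Finset.mem_union, mem_topAt, mem_ownAt, Finset.mem_map, mem_realAt,
      Function.Embedding.inl_apply]
    constructor
    · intro hx
      have hl := mem_listH'_of_mem_atLevel hM' hx
      simp only [List.mem_append, List.mem_map] at hl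
      rcases hl with (hl | ⟨r, -, rfl⟩) | hl
      · exact Or.inl (Or.inl ⟨hx, hl⟩)
      · exact Or.inl (Or.inr ⟨r, hx, rfl⟩)
      · exact Or.inr ⟨hx, hl⟩
    · rintro ((hx | ⟨r, hr, rfl⟩) | hx)
      exacts [hx.1, hr, hx.1]
  · rw [Finset.disjoint_left]
    rintro x hx hx'
    obtain ⟨t, i, ht, rfl⟩ := (G.mem_dummies _ _ _).1 (mem_ownAt.1 hx').2
    rcases Finset.mem_union.1 hx with hx | hx
    · obtain ⟨t', i', ht', -, he⟩ := (G.mem_topDummies _ _ _).1 (mem_topAt.1 hx).2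
      simp only [Sum.inr.injEq, Sigma.mk.injEq, heq_eq_eq, true_and] at he
      rw [he.1] at ht
      omega
    · simp at hx
  · rw [Finset.disjoint_left]
    rintro x hx hx'
    obtain ⟨r, -, rfl⟩ := Finset.mem_map.1 hx'
    obtain ⟨t, i, -, -, he⟩ := (G.mem_topDummies _ _ _).1 (mem_topAt.1 hx).2
    simp at he

/-- If a level-`s` dummy is not at level `s`, its first choice, then the level-`s` copy is full with
better residents. -/
theorem full_of_dummy_notMem (hM' : G.reduction.IsStable M') {h : H} {s : ℕ}
    (hs : s < G.numLevels) {d : G.Resident'} (hd : d ∈ G.dummies h s)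
    (hd' : d ∉ G.atLevel M' h s) : (G.atLevel M' h s).card = G.copyCap h s ∧
      ∀ x ∈ G.atLevel M' h s, ¬ Prefers (G.listH' (h, ⟨s, hs⟩)) (some d) (some x) := by
  obtain ⟨l, hl⟩ := G.listR'_of_mem_dummies hs hd
  have hmem : (h, (⟨s, hs⟩ : Fin G.numLevels)) ∈ G.listR' d := by rw [hl]; simp
  rw [atLevel_eq_residentsOf hs] at hd' ⊢
  rw [mem_residentsOf] at hd'
  refine hM'.not_blocks hmem ?_
  rcases hx : hospitalOf M' d with _ | y
  · exact hmem
  · have hy := hM'.1.hospitalOf_eq_some_iff.1 hx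
    have hyl : y ∈ G.listR' d := hM'.1.edge _ _ hy
    have hne : y ≠ (h, (⟨s, hs⟩ : Fin G.numLevels)) := by
      rintro rfl
      exact hd' hy
    refine prefers_of_pair_sublist (G.nodup_listR' d) ?_
    rw [hl] at hyl ⊢
    exact (List.singleton_sublist.2 ((List.mem_cons.1 hyl).resolve_left hne)).cons_cons _

/-- A dummy with two neighbours is always matched: the copy of level `s + 1` has room for all of
them and prefers them to everybody else. -/
theorem dummy_matched (hM' : G.reduction.IsStable M') {h : H} (hq : G.lower h ≤ G.upper h) {s : ℕ}
    (hs : s + 1 < G.numLevels) {d : G.Resident'} (hd : d ∈ G.topDummies h (s + 1)) :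
    d ∈ G.atLevel M' h s ∨ d ∈ G.atLevel M' h (s + 1) := by
  by_contra! hn
  have hl := G.listR'_of_mem_topDummies hs hd
  have hmem : (h, (⟨s + 1, hs⟩ : Fin G.numLevels)) ∈ G.listR' d := by rw [hl]; simp
  have hp : Prefers (G.listR' d) (some (h, (⟨s + 1, hs⟩ : Fin G.numLevels)))
      (hospitalOf M' d) := by
    rcases hx : hospitalOf M' d with _ | y
    · exact hmem
    · exfalso
      have hy := hM'.1.hospitalOf_eq_some_iff.1 hx
      have hyl : y ∈ G.listR' d := hM'.1.edge _ _ hy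
      rw [hl] at hyl
      simp only [List.mem_cons, List.not_mem_nil, or_false] at hyl
      rcases hyl with rfl | rfl
      · exact hn.1 (mem_atLevel.2 ⟨_, hy⟩)
      · exact hn.2 (mem_atLevel.2 ⟨_, hy⟩)
  have hb := hM'.not_blocks hmem hp
  rw [← atLevel_eq_residentsOf hs] at hb
  have hsub : G.atLevel M' h (s + 1) ⊆ (G.topDummies h (s + 1)).toFinset.erase d := by
    intro x hx
    rw [Finset.mem_erase, List.mem_toFinset]
    refine ⟨fun he => hn.2 (he ▸ hx), ?_⟩
    by_contra hxt
    exact hb.2 x hx (G.prefers_listH'_topDummy (s := ⟨s + 1, hs⟩) hd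
      (mem_listH'_of_mem_atLevel hM'.1 hx) hxt)
  have hlt := Finset.card_lt_card (Finset.ssubset_of_subset_of_ssubset hsub
    (Finset.erase_ssubset (List.mem_toFinset.2 hd)))
  rw [List.toFinset_card_of_nodup (G.nodup_topDummies _ _), G.length_topDummies hq hs, hb.1] at hlt
  exact lt_irrefl _ hlt

theorem card_topAt_le (h : H) (s : ℕ) :
    (G.topAt M' h s).card ≤ (G.topDummies h s).length := by
  rw [← List.toFinset_card_of_nodup (G.nodup_topDummies h s)]
  exact Finset.card_le_card fun x hx => List.mem_toFinset.2 (mem_topAt.1 hx).2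

/-- The dummies that the level-`s` copy passes on to the next level are displaced by the other
residents there. -/
theorem card_topAt_succ_le (hM' : G.reduction.IsStable M') (h : H) {s : ℕ}
    (hs : s + 1 < G.numLevels) :
    (G.topAt M' h (s + 1)).card ≤ (G.topAt M' h s).card + (G.realAt M' h s).card := by
  have hne : ∀ d ∈ G.topAt M' h (s + 1), d ∈ G.dummies h s ∧ d ∉ G.atLevel M' h s := by
    intro d hd
    obtain ⟨h1, h2⟩ := mem_topAt.1 hd
    exact ⟨G.topDummies_succ_subset h s h2, fun h3 => by
      have := eq_of_mem_atLevel hM'.1 h1 h3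
      omega⟩
  rcases (G.topAt M' h (s + 1)).eq_empty_or_nonempty with he | ⟨d, hd⟩
  · simp [he]
  have hfull := (full_of_dummy_notMem hM' (by omega) (hne d hd).1 (hne d hd).2).1
  have hsub : G.topAt M' h (s + 1) ∪ G.ownAt M' h s ⊆ (G.dummies h s).toFinset := by
    intro x hx
    rw [List.mem_toFinset]
    rcases Finset.mem_union.1 hx with hx | hx
    · exact (hne x hx).1
    · exact (mem_ownAt.1 hx).2
  have hdisj : Disjoint (G.topAt M' h (s + 1)) (G.ownAt M' h s) := by
    rw [Finset.disjoint_left]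
    exact fun x hx hx' => (hne x hx).2 (mem_ownAt.1 hx').1
  have hc := Finset.card_le_card hsub
  rw [Finset.card_union_of_disjoint hdisj, List.toFinset_card_of_nodup (G.nodup_dummies _ _),
    G.length_dummies h hs] at hc
  rw [card_atLevel hM'.1] at hfull
  omega

/-- Unless the copy of level `s + 1` is full with level-`s` dummies, it receives at least as many of
them as the level-`s` copy holds residents other than its own dummies. -/
theorem le_card_topAt_succ (hM' : G.reduction.IsStable M') {h : H} (hq : G.lower h ≤ G.upper h)
    {s : ℕ} (hs : s + 1 < G.numLevels) (hlt : (G.topAt M' h (s + 1)).card < G.copyCap h (s + 1)) :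
    (G.topAt M' h s).card + (G.realAt M' h s).card ≤ (G.topAt M' h (s + 1)).card := by
  obtain ⟨d₀, hd₀, hd₀'⟩ : ∃ d ∈ G.topDummies h (s + 1), d ∉ G.atLevel M' h (s + 1) := by
    by_contra! hall
    refine hlt.not_ge ?_
    rw [← G.length_topDummies hq hs, ← List.toFinset_card_of_nodup (G.nodup_topDummies _ _)]
    refine Finset.card_le_card fun d hd => ?_
    rw [List.mem_toFinset] at hd
    exact mem_topAt.2 ⟨hall d hd, hd⟩
  have hd₀s := (dummy_matched hM' hq hs hd₀).resolve_right hd₀'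
  have hsub : (G.dummies h s).toFinset ⊆ G.ownAt M' h s ∪ G.topAt M' h (s + 1) := by
    intro d hd
    rw [List.mem_toFinset] at hd
    rw [Finset.mem_union]
    by_cases hds : d ∈ G.atLevel M' h s
    · exact Or.inl (mem_ownAt.2 ⟨hds, hd⟩)
    -- `d` would displace `d₀` if it had no edge to level `s + 1`
    · have hdt : d ∈ G.topDummies h (s + 1) := by
        by_contra hdt
        exact (full_of_dummy_notMem hM' (by omega) hd hds).2 d₀ hd₀s
          (G.prefers_listH'_dummy (s := ⟨s, by omega⟩) hd hdt hd₀)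
      exact Or.inr (mem_topAt.2 ⟨(dummy_matched hM' hq hs hdt).resolve_left hds, hdt⟩)
  have hc := (Finset.card_le_card hsub).trans (Finset.card_union_le _ _)
  rw [List.toFinset_card_of_nodup (G.nodup_dummies _ _), G.length_dummies h hs] at hc
  have := card_atLevel_le hM'.1 h (s := s) (by omega)
  rw [card_atLevel hM'.1] at this
  omega

theorem realBelow_numLevels (hM' : G.reduction.IsMatching M') (h : H) :
    G.realBelow M' h G.numLevels = (residentsOf (G.mapBack M') h).card := by
  have e : residentsOf (G.mapBack M') h =
      (Finset.range G.numLevels).biUnion (G.realAt M' h) := by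
    ext r
    simp only [mem_residentsOf, mem_mapBack, Finset.mem_biUnion, Finset.mem_range, mem_realAt,
      mem_atLevel]
    exact ⟨fun ⟨s, hs⟩ => ⟨s, s.2, s.2, hs⟩, fun ⟨s, _, hs, hm⟩ => ⟨⟨s, hs⟩, hm⟩⟩
  rw [e, Finset.card_biUnion, realBelow]
  intro s _ s' _ hne
  rw [Function.onFun, Finset.disjoint_left]
  intro r hr hr'
  exact hne (eq_of_mem_atLevel hM' (mem_realAt.1 hr) (mem_realAt.1 hr'))

/-- The dummies received from the previous level count the residents at lower levels, truncated at
the capacity. -/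
theorem card_topAt (hM' : G.reduction.IsStable M') {h : H} (hq : G.lower h ≤ G.upper h) {s : ℕ}
    (hs : s < G.numLevels) :
    (G.topAt M' h s).card = min (G.copyCap h s) (G.realBelow M' h s) := by
  induction s with
  | zero => simp [topAt_zero, realBelow]
  | succ s ih =>
    have ih := ih (by omega)
    have h1 := card_topAt_succ_le hM' h hs
    have h2 := le_card_topAt_succ hM' hq hs
    have h3 := card_topAt_le (M' := M') h (s + 1)
    rw [G.length_topDummies hq hs] at h3
    have h4 := G.copyCap_succ_le hq s
    rw [realBelow_succ]
    omega

theorem topAt_add_realAt_le (hM' : G.reduction.IsMatching M') (h : H) {s : ℕ}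
    (hs : s < G.numLevels) :
    (G.topAt M' h s).card + (G.realAt M' h s).card ≤ G.copyCap h s := by
  have := card_atLevel_le hM' h hs
  rw [card_atLevel hM'] at this
  omega

/-- A copy has slack if the residents other than its own dummies do not fill it. -/
theorem slack_of_lt (hM' : G.reduction.IsMatching M') {h : H} {s : Fin G.numLevels}
    (hlt : (G.topAt M' h s).card + (G.realAt M' h s).card < G.copyCap h s) :
    G.Slack M' (h, s) := by
  rcases (G.ownAt M' h s).eq_empty_or_nonempty with he | ⟨d, hd⟩
  · left
    have := card_atLevel hM' h s
    rw [he, Finset.card_empty, add_zero, atLevel_eq_residentsOf s.2] at this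
    exact this.trans_lt hlt
  · right
    obtain ⟨h1, h2⟩ := mem_ownAt.1 hd
    rw [atLevel_eq_residentsOf s.2] at h1
    exact ⟨d, h1, h2⟩

/-- If a resident is at the level-`t` copy with `t = s + 1`, then this copy has not received all
dummies that the previous level could pass on, so that one of these is left at level `s`. -/
theorem slack_of_mem_succ (hM' : G.reduction.IsStable M') {h : H} (hq : G.lower h ≤ G.upper h)
    {r : R} {s t : Fin G.numLevels} (hst : (t : ℕ) = s + 1) (hr : (Sum.inl r, (h, t)) ∈ M') :
    G.Slack M' (h, s) := by
  have hs : (s : ℕ) + 1 < G.numLevels := hst ▸ t.2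
  have hpos : 0 < (G.realAt M' h (s + 1)).card :=
    Finset.card_pos.2 ⟨r, mem_realAt.2 (mem_atLevel.2 ⟨hs, by
      rwa [show (⟨s + 1, hs⟩ : Fin G.numLevels) = t from Fin.ext hst.symm]⟩)⟩
  have h1 := topAt_add_realAt_le hM'.1 h hs
  have h2 := le_card_topAt_succ hM' hq hs (by omega)
  have h3 := G.copyCap_succ_le hq s
  exact slack_of_lt hM'.1 (by omega)

/-- A hospital with a resident at level at least `2` has at most `lower h` residents. -/
theorem card_le_lower_of_two_le (hM' : G.reduction.IsStable M') {h : H}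
    (hq : G.lower h ≤ G.upper h) {r : R} {s : Fin G.numLevels} (hs : 2 ≤ (s : ℕ))
    (hr : (Sum.inl r, (h, s)) ∈ M') :
    (residentsOf (G.mapBack M') h).card ≤ G.lower h := by
  have cap : ∀ t, 2 ≤ t → G.copyCap h t = G.lower h := fun t ht => if_neg (by omega)
  have hpos : 0 < (G.realAt M' h s).card :=
    Finset.card_pos.2 ⟨r, mem_realAt.2 (mem_atLevel.2 ⟨s.2, hr⟩)⟩
  have h0 : G.realBelow M' h s ≤ G.lower h := by
    have h1 := topAt_add_realAt_le hM'.1 h s.2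
    have h2 := card_topAt hM' hq s.2
    rw [cap s hs] at h1 h2
    omega
  have key : ∀ k, s + k ≤ G.numLevels → G.realBelow M' h (s + k) ≤ G.lower h := by
    intro k
    induction k with
    | zero => exact fun _ => h0
    | succ k ih =>
      intro hk
      have h1 := topAt_add_realAt_le hM'.1 h (s := s + k) (by omega)
      have h2 := card_topAt hM' hq (s := s + k) (by omega)
      have h3 := ih (by omega)
      rw [cap _ (by omega)] at h1 h2
      rw [← add_assoc, realBelow_succ]
      omega
  rw [← realBelow_numLevels hM'.1]
  have := key (G.numLevels - s) (by omega)
  rwa [Nat.add_sub_cancel' s.2.le] at this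

theorem realBelow_two (hM' : G.reduction.IsStable M') {h : H} (hq : G.lower h ≤ G.upper h) :
    G.realBelow M' h 2 = (G.topAt M' h 1).card + (G.realAt M' h 1).card := by
  have h1 := topAt_add_realAt_le hM'.1 h (s := 0) (by have := G.two_le_numLevels; omega)
  have h2 := card_topAt hM' hq (s := 1) (by have := G.two_le_numLevels; omega)
  have e : G.realBelow M' h 1 = (G.realAt M' h 0).card := by simp [realBelow]
  have c0 : G.copyCap h 0 = G.upper h := rfl
  have c1 : G.copyCap h 1 = G.upper h := rfl
  rw [realBelow_succ]
  omega

theorem card_le_upper (hM' : G.reduction.IsStable M') {h : H} (hq : G.lower h ≤ G.upper h) :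
    (residentsOf (G.mapBack M') h).card ≤ G.upper h := by
  by_cases hex : ∃ r, ∃ s : Fin G.numLevels, 2 ≤ (s : ℕ) ∧ (Sum.inl r, (h, s)) ∈ M'
  · obtain ⟨r, s, hs, hr⟩ := hex
    exact (card_le_lower_of_two_le hM' hq hs hr).trans hq
  · have h1 := topAt_add_realAt_le hM'.1 h (s := 1) (by have := G.two_le_numLevels; omega)
    rw [← realBelow_two hM' hq] at h1
    refine le_trans (le_of_eq ?_) h1
    rw [← realBelow_numLevels hM'.1]
    refine (Finset.sum_subset (Finset.range_subset_range.2 G.two_le_numLevels) ?_).symm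
    intro s _ hs
    rw [Finset.card_eq_zero, Finset.eq_empty_iff_forall_notMem]
    intro r hr
    obtain ⟨hsl, hm⟩ := mem_atLevel.1 (mem_realAt.1 hr)
    exact hex ⟨r, ⟨s, hsl⟩, not_lt.1 fun h => hs (Finset.mem_range.2 h), hm⟩

/-- A hospital that is not full has slack at level `1`. -/
theorem slack_one (hM' : G.reduction.IsStable M') {h : H} (hq : G.lower h ≤ G.upper h)
    (hlt : (residentsOf (G.mapBack M') h).card < G.upper h) :
    G.Slack M' (h, ⟨1, G.two_le_numLevels⟩) := by
  refine slack_of_lt hM'.1 (s := ⟨1, G.two_le_numLevels⟩) ?_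
  have h1 := realBelow_mono (M' := M') h G.two_le_numLevels
  rw [realBelow_two hM' hq, realBelow_numLevels hM'.1] at h1
  exact h1.trans_lt hlt

/-- A deficient hospital has slack at the highest level. -/
theorem slack_last (hM' : G.reduction.IsStable M') {h : H} (hq : G.lower h ≤ G.upper h)
    (hlt : (residentsOf (G.mapBack M') h).card < G.lower h) :
    G.Slack M' (h, ⟨G.numLevels - 1, by have := G.two_le_numLevels; omega⟩) := by
  have hl := G.two_le_numLevels
  refine slack_of_lt hM'.1 (s := ⟨G.numLevels - 1, by omega⟩) ?_
  have h1 := card_topAt hM' hq (s := G.numLevels - 1) (by omega)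
  have h2 := realBelow_succ (M' := M') h (G.numLevels - 1)
  rw [Nat.sub_add_cancel (by omega), realBelow_numLevels hM'.1] at h2
  have h3 : G.lower h ≤ G.copyCap h (G.numLevels - 1) := by
    unfold copyCap
    split_ifs
    exacts [hq, le_rfl]
  simp only
  omega

theorem isMatching_mapBack (hM' : G.reduction.IsStable M') (hq : ∀ h, G.lower h ≤ G.upper h) :
    G.IsMatching (G.mapBack M') := by
  refine ⟨fun r h hm => ?_, fun r h₁ h₂ h1 h2 => ?_, fun h => card_le_upper hM' (hq h)⟩
  · obtain ⟨s, hs⟩ := mem_mapBack.1 hm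
    exact G.mem_listR'_inl.1 (hM'.1.edge _ _ hs)
  · obtain ⟨s, hs⟩ := mem_mapBack.1 h1
    obtain ⟨s', hs'⟩ := mem_mapBack.1 h2
    exact congrArg Prod.fst (hM'.1.resident _ _ _ hs hs')

end Reduction

end HRLQInstance

namespace HRLQInstance

section Popularity

variable {R H : Type*} [Fintype R] [DecidableEq R] [Fintype H] [DecidableEq H]
  {G : HRLQInstance R H} {M' : Finset (G.Resident' × G.Hospital')} {N : Finset (R × H)}

theorem IsFeasible.lower_le_upper {R H : Type*} [Fintype R] [DecidableEq R] [DecidableEq H]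
    {G : HRLQInstance R H} {N : Finset (R × H)} (hN : G.IsFeasible N) (h : H) :
    G.lower h ≤ G.upper h :=
  (hN.2 h).trans (hN.1.hospital h)

/-! ### Feasibility -/

/-- A deficient hospital has slack at the highest level.  Let `X s` be the set of the hospitals that
are deficient or have a resident at level at least `s`.  By slackness, all residents that a feasible
matching assigns to `X (s + 1)` are at level at least `s`, and so belong to `X s`; this makes the
total lower quota of `X s` strictly increase as `s` decreases.  There are more levels than the sum
of all lower quotas allows. -/
theorem isFeasible_mapBack (hM' : G.reduction.IsStable M') (hN : G.IsFeasible N) :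
    G.IsFeasible (G.mapBack M') := by
  classical
  have hq := hN.lower_le_upper
  refine ⟨isMatching_mapBack hM' hq, ?_⟩
  by_contra! hdef
  obtain ⟨h₀, hh₀⟩ := hdef
  let X : ℕ → Finset H := fun s => Finset.univ.filter fun h =>
    (residentsOf (G.mapBack M') h).card < G.lower h ∨
      ∃ r, ∃ t : Fin G.numLevels, s ≤ t ∧ (Sum.inl r, (h, t)) ∈ M'
  have memX : ∀ s h, h ∈ X s ↔ (residentsOf (G.mapBack M') h).card < G.lower h ∨
      ∃ r, ∃ t : Fin G.numLevels, s ≤ t ∧ (Sum.inl r, (h, t)) ∈ M' := fun s h => by simp [X]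
  have step : ∀ s, 2 ≤ s → s < G.numLevels →
      ∑ h ∈ X (s + 1), G.lower h < ∑ h ∈ X s, G.lower h := by
    intro s hs2 hsl
    have level : ∀ h ∈ X (s + 1), ∀ r, (r, h) ∈ N →
        ∃ h', ∃ t : Fin G.numLevels, s ≤ t ∧ (Sum.inl r, (h', t)) ∈ M' := by
      intro h hh r hr
      rcases (memX _ _).1 hh with hh | ⟨x, t, hst, hx⟩
      · obtain ⟨h', t, hm, ht⟩ := (slack_last hM' (hq h) hh).exists_mem hM' (hN.1.edge _ _ hr)
        refine ⟨h', t, ?_, hm⟩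
        rcases ht with ht | ⟨ht, -⟩
        · have := Fin.lt_def.1 ht
          simp only at this
          omega
        · rw [← ht]
          simp only
          omega
      · obtain ⟨t', ht'⟩ : ∃ t' : Fin G.numLevels, (t : ℕ) = t' + 1 :=
          ⟨⟨t - 1, by omega⟩, by simp only; omega⟩
        obtain ⟨h', u, hm, hu⟩ :=
          (slack_of_mem_succ hM' (hq h) ht' hx).exists_mem hM' (hN.1.edge _ _ hr)
        refine ⟨h', u, ?_, hm⟩
        rcases hu with hu | ⟨hu, -⟩
        · have := Fin.lt_def.1 hu
          omega
        · rw [← hu]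
          omega
    calc ∑ h ∈ X (s + 1), G.lower h
        ≤ ∑ h ∈ X (s + 1), (residentsOf N h).card := Finset.sum_le_sum fun h _ => hN.2 h
      _ = ((X (s + 1)).biUnion (residentsOf N)).card := by
          rw [Finset.card_biUnion]
          intro h _ h' _ hne
          rw [Function.onFun, Finset.disjoint_left]
          intro r hr hr'
          exact hne (hN.1.resident _ _ _ (mem_residentsOf.1 hr) (mem_residentsOf.1 hr'))
      _ ≤ ((X s).biUnion (residentsOf (G.mapBack M'))).card := by
          refine Finset.card_le_card fun r hr => ?_
          obtain ⟨h, hh, hr⟩ := Finset.mem_biUnion.1 hr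
          obtain ⟨h', t, ht, hm⟩ := level h hh r (mem_residentsOf.1 hr)
          exact Finset.mem_biUnion.2 ⟨h', (memX _ _).2 (Or.inr ⟨r, t, ht, hm⟩),
            mem_residentsOf.2 (mem_mapBack.2 ⟨t, hm⟩)⟩
      _ ≤ ∑ h ∈ X s, (residentsOf (G.mapBack M') h).card := Finset.card_biUnion_le
      _ < ∑ h ∈ X s, G.lower h := by
          refine Finset.sum_lt_sum (fun h hh => ?_) ⟨h₀, (memX _ _).2 (Or.inl hh₀), hh₀⟩
          rcases (memX _ _).1 hh with hh | ⟨r, t, ht, hr⟩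
          · exact hh.le
          · exact card_le_lower_of_two_le hM' (hq h) (hs2.trans ht) hr
  have hl := G.two_le_numLevels
  have key : ∀ j, j + 2 ≤ G.numLevels → j + 1 ≤ ∑ h ∈ X (G.numLevels - j), G.lower h := by
    intro j
    induction j with
    | zero =>
      intro _
      have := Finset.single_le_sum (f := G.lower) (fun _ _ => Nat.zero_le _)
        ((memX (G.numLevels - 0) h₀).2 (Or.inl hh₀))
      omega
    | succ j ih =>
      intro hj
      have h1 := ih (by omega)
      have h2 := step (G.numLevels - (j + 1)) (by omega) (by omega)
      rw [show G.numLevels - (j + 1) + 1 = G.numLevels - j by omega] at h2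
      omega
  have h1 := key (G.numLevels - 2) (by omega)
  have h2 : ∑ h ∈ X (G.numLevels - (G.numLevels - 2)), G.lower h ≤ ∑ h, G.lower h :=
    Finset.sum_le_sum_of_subset (Finset.subset_univ _)
  have h3 : G.numLevels = 2 + ∑ h, G.lower h := rfl
  omega

/-! ### Popularity -/

/-- The level at which a resident is matched, and `0` for unmatched residents. -/
noncomputable def level (G : HRLQInstance R H) (M' : Finset (G.Resident' × G.Hospital'))
    (r : R) : ℕ :=
  (hospitalOf M' (Sum.inl r)).elim 0 fun x => x.2

theorem level_eq (hM' : G.reduction.IsMatching M') {r : R} {h : H} {s : Fin G.numLevels}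
    (hr : (Sum.inl r, (h, s)) ∈ M') : G.level M' r = s := by
  rw [level, hM'.hospitalOf_eq_some_iff.2 hr, Option.elim_some]

theorem hospitalOf_mapBack (hM' : G.reduction.IsStable M') (hq : ∀ h, G.lower h ≤ G.upper h)
    {r : R} {h : H} {s : Fin G.numLevels} (hr : (Sum.inl r, (h, s)) ∈ M') :
    hospitalOf (G.mapBack M') r = some h :=
  (isMatching_mapBack hM' hq).hospitalOf_eq_some_iff.2 (mem_mapBack.2 ⟨s, hr⟩)

theorem hospitalOf_eq_none_of_mapBack {r : R} (hr : hospitalOf (G.mapBack M') r = none) :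
    hospitalOf M' (Sum.inl r) = none :=
  hospitalOf_eq_none_iff.2 fun x hx =>
    hospitalOf_eq_none_iff.1 hr x.1 (mem_mapBack.2 ⟨x.2, hx⟩)

/-- The votes of both ends of an edge `(r, h)` of `N`, where `h` compares `r` with a resident `x`
assigned to it, are bounded by twice the difference of the levels of `r` and `x`. -/
theorem voteR_add_vote_le (hM' : G.reduction.IsStable M') (hq : ∀ h, G.lower h ≤ G.upper h)
    (hN : G.IsMatching N) {h : H} {r x : R} (hr : (r, h) ∈ N) (hr' : (r, h) ∉ G.mapBack M')
    (hx : (x, h) ∈ G.mapBack M') :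
    G.voteR N (G.mapBack M') r + vote (G.listH h) (some r) (some x) ≤
      2 * ((G.level M' r : ℤ) - G.level M' x) := by
  have hrl : h ∈ G.listR r := hN.edge _ _ hr
  have hxl : h ∈ G.listR x := (isMatching_mapBack hM' hq).edge _ _ hx
  have hrx : r ≠ x := by
    rintro rfl
    exact hr' hx
  obtain ⟨s, hs⟩ := mem_mapBack.1 hx
  have hNr := hN.hospitalOf_eq_some_iff.2 hr
  rw [level_eq hM'.1 hs]
  have hv1 := vote_le_one (G.listR r) (hospitalOf N r) (hospitalOf (G.mapBack M') r)
  have hv2 := vote_le_one (G.listH h) (some r) (some x)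
  rw [voteR]
  -- if `r` would move to the copy of `h` holding `x`, then `h` votes for `x`
  have hvote : Prefers (G.listR' (Sum.inl r)) (some (h, s)) (hospitalOf M' (Sum.inl r)) →
      vote (G.listH h) (some r) (some x) = -1 := by
    intro hp
    have h1 := (hM'.not_blocks (G.mem_listR'_inl.2 hrl) hp).2 _ (mem_residentsOf.2 hs)
    refine vote_eq_neg_one ((prefers_or_prefers ((G.mem_iff _ _).1 hrl) ((G.mem_iff _ _).1 hxl)
      hrx).resolve_left fun hp' => h1 (G.prefers_listH'_inl s hp'))
  -- for `s ≥ 1` the copy below the one holding `x` has slack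
  have hslack : 0 < (s : ℕ) → ∃ h' s', (Sum.inl r, (h', s')) ∈ M' ∧
      ((s : ℕ) ≤ s' ∨ (s : ℕ) = s' + 1 ∧
        (h' = h ∨ Prefers (G.listR r) (some h') (some h))) := by
    intro hs0
    obtain ⟨t, ht⟩ : ∃ t : Fin G.numLevels, (s : ℕ) = t + 1 :=
      ⟨⟨s - 1, by omega⟩, by simp only; omega⟩
    obtain ⟨h', s', hm, hc⟩ := (slack_of_mem_succ hM' (hq h) ht hs).exists_mem hM' hrl
    refine ⟨h', s', hm, hc.imp (fun hlt => ?_) (fun he => ⟨?_, he.2⟩)⟩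
    · have := Fin.lt_def.1 hlt
      omega
    · rw [← he.1, ht]
  rcases hMr : hospitalOf M' (Sum.inl r) with _ | ⟨h', s'⟩
  · have hs0 : (s : ℕ) = 0 := by
      by_contra hne
      obtain ⟨h', s', hm, -⟩ := hslack (by omega)
      exact hospitalOf_eq_none_iff.1 hMr _ hm
    have h2 := hvote (by rw [hMr]; exact G.mem_listR'_inl.2 hrl)
    rw [level, hMr, Option.elim_none, hs0, h2]
    push_cast
    linarith
  · have hm := hM'.1.hospitalOf_eq_some_iff.1 hMr
    have hM1 := hospitalOf_mapBack hM' hq hm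
    have hne : h' ≠ h := by
      rintro rfl
      exact hr' (mem_mapBack.2 ⟨s', hm⟩)
    have hrl' : h' ∈ G.listR r := G.mem_listR'_inl.1 (hM'.1.edge _ _ hm)
    rw [level_eq hM'.1 hm]
    rw [hM1, hNr] at hv1 ⊢
    rcases lt_trichotomy s s' with hlt | rfl | hlt
    · have := Fin.lt_def.1 hlt
      zify at this
      linarith
    · rcases prefers_or_prefers hrl hrl' hne.symm with hp | hp
      · have := hvote (by rw [hMr]; exact G.prefers_listR'_of_prefers s hp)
        linarith
      · have := vote_eq_neg_one hp
        linarith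
    · have h2 := hvote (by rw [hMr]; exact G.prefers_listR'_of_lt hrl hrl' hlt)
      have hlt := Fin.lt_def.1 hlt
      obtain ⟨h'', s'', hm'', hc⟩ := hslack (by omega)
      obtain ⟨rfl, rfl⟩ : h'' = h' ∧ s'' = s' := by
        simpa using hM'.1.resident _ _ _ hm'' hm
      obtain ⟨he, hp⟩ := hc.resolve_left (by omega)
      have h1 := vote_eq_neg_one (hp.resolve_left hne)
      rw [h1, h2, he]
      push_cast
      linarith

/-- The image of a stable matching does not lose against any feasible matching: the levels of the
residents are heights as required by the duality argument. -/
theorem delta_mapBack_nonpos (hM' : G.reduction.IsStable M') (hN : G.IsFeasible N)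
    (c : G.Correspondence) : G.delta c N (G.mapBack M') ≤ 0 := by
  have hq := hN.lower_le_upper
  have hM := isMatching_mapBack hM' hq
  refine delta_nonpos_of_heights c hM hN.1 (fun r => (G.level M' r : ℤ)) ?_ ?_ ?_ ?_ ?_
  · exact fun h r x hr hr' hx _ => voteR_add_vote_le hM' hq hN.1 hr hr' hx
  · intro h r hr hr' hlt
    have hrl := hN.1.edge _ _ hr
    obtain ⟨h', s', hm, hs⟩ :=
      (slack_one hM' (hq h) (hlt.trans_le (hN.1.hospital h))).exists_mem hM' hrl
    rw [level_eq hM'.1 hm]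
    rcases hs with hs | ⟨rfl, hp⟩
    · have hs := Fin.lt_def.1 hs
      simp only at hs
      have := vote_le_one (G.listR r) (hospitalOf N r) (hospitalOf (G.mapBack M') r)
      rw [voteR]
      zify at hs
      linarith
    · have hne : h' ≠ h := by
        rintro rfl
        exact hr' (mem_mapBack.2 ⟨_, hm⟩)
      rw [voteR, hN.1.hospitalOf_eq_some_iff.2 hr, hospitalOf_mapBack hM' hq hm,
        vote_eq_neg_one (hp.resolve_left hne)]
      simp
  · intro h x hx _ hlt
    obtain ⟨s, hs⟩ := mem_mapBack.1 hx
    rw [level_eq hM'.1 hs]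
    by_contra hgt
    have h2 : 2 ≤ (s : ℕ) := by
      by_contra h2
      exact hgt (by norm_cast; omega)
    exact ((hN.2 h).trans_lt hlt).not_ge (card_le_lower_of_two_le hM' (hq h) h2 hs)
  · exact fun r => Int.natCast_nonneg _
  · intro r hr
    rw [level, hospitalOf_eq_none_of_mapBack hr]
    rfl

theorem delta_mapBack_le (hM' : G.reduction.IsStable M') (hN : G.IsFeasible N)
    (c : G.Correspondence) : G.delta c N (G.mapBack M') ≤ G.delta c (G.mapBack M') N := by
  have h1 := delta_mapBack_nonpos hM' hN c
  have h2 := delta_swap c (isMatching_mapBack hM' hN.lower_le_upper) hN.1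
  linarith

theorem isPopularFeasible_mapBack (hM' : G.reduction.IsStable M') (hN : ∃ N, G.IsFeasible N)
    (c : G.Correspondence) : G.IsPopularFeasible c (G.mapBack M') := by
  obtain ⟨N, hN⟩ := hN
  exact ⟨isFeasible_mapBack hM' hN, fun N' hN' => (delta_mapBack_le hM' hN' c).not_gt⟩

theorem IsComponentUnion.mapBack_symmDiff {ρ : Finset (R × H)} {c : G.Correspondence}
    (hM' : G.reduction.IsStable M') (hN : G.IsFeasible N)
    (hρ : G.IsComponentUnion c (G.mapBack M') N ρ) :
    G.IsFeasible (G.mapBack M' ∆ ρ) ∧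
      G.delta c (G.mapBack M' ∆ ρ) (G.mapBack M') ≤
        G.delta c (G.mapBack M') (G.mapBack M' ∆ ρ) := by
  have hf := hρ.isFeasible_symmDiff (isFeasible_mapBack hM' hN) hN
  exact ⟨hf, delta_mapBack_le hM' hf c⟩

end Popularity

end HRLQInstance

theorem mainTheorem1 {R H : Type*} [Fintype R] [DecidableEq R] [Fintype H] [DecidableEq H]
    (G : HRLQInstance R H) :
    -- for the image `M` of any stable matching of the reduced instance, and any feasible `N` :
    (∀ M', G.reduction.IsStable M' → ∀ M, M = G.mapBack M' → ∀ N, G.IsFeasible N →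
      ∀ c : G.Correspondence,
        -- alternating cycles
        (∀ ρ, G.IsAltCycle c M N ρ →
          G.IsFeasible (M ∆ ρ) ∧ G.delta c (M ∆ ρ) M ≤ G.delta c M (M ∆ ρ)) ∧
        -- alternating paths with exactly one end-point matched in `M`
        (∀ ρ e f u v, G.IsAltPath c M N ρ e f u v → (e ∈ M ∧ f ∉ M) ∨ (e ∉ M ∧ f ∈ M) →
          G.IsFeasible (M ∆ ρ) ∧ G.delta c (M ∆ ρ) M ≤ G.delta c M (M ∆ ρ)) ∧
        -- alternating paths with both end-points matched in `M`
        (∀ ρ e f u v, G.IsAltPath c M N ρ e f u v → e ∈ M ∧ f ∈ M →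
          G.IsFeasible (M ∆ ρ) ∧ G.delta c (M ∆ ρ) M ≤ G.delta c M (M ∆ ρ))) ∧
    -- if there is a feasible matching, then every such `M` is popular among feasible matchings
    ((∃ N, G.IsFeasible N) → ∀ M', G.reduction.IsStable M' →
      ∀ c : G.Correspondence, G.IsPopularFeasible c (G.mapBack M')) ∧
    -- and such an `M` exists
    ((∃ N, G.IsFeasible N) → ∃ M', G.reduction.IsStable M' ∧
      ∀ c : G.Correspondence, G.IsPopularFeasible c (G.mapBack M')) := by
  refine ⟨?_, fun hN M' hM' c => HRLQInstance.isPopularFeasible_mapBack hM' hN c, fun hN => ?_⟩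
  · rintro M' hM' _ rfl N hN c
    have hM := HRLQInstance.isMatching_mapBack hM' hN.lower_le_upper
    exact ⟨fun ρ hρ => (hρ.isComponentUnion hM hN.1).mapBack_symmDiff hM' hN,
      fun ρ e f u v hρ _ => (hρ.isComponentUnion hM hN.1).mapBack_symmDiff hM' hN,
      fun ρ e f u v hρ _ => (hρ.isComponentUnion hM hN.1).mapBack_symmDiff hM' hN⟩
  · obtain ⟨M', hM'⟩ := G.reduction.exists_isStable
    exact ⟨M', hM', fun c => HRLQInstance.isPopularFeasible_mapBack hM' hN c⟩
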